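/- Let $X$ be a real Banach space and let $G$ be a compact topological group with normalized Haar measure $\mu$, acting continuously, linearly and isometrically on $X$. **Assumption on the action.** Assume $X=\overline{\bigoplus_{j\ge 1}X_j}$, where the sum is direct, each $X_j$ is a $G$-invariant subspace, and each $X_j$ is isomorphic, as a representation of $G$, to one fixed finite dimensional real continuous representation $Y$ of $G$ whose action is *admissible*: for all $k\ge 2$, all bounded $G$-invariant open sets $U\subset Y^k$ with $0\in U$, and all continuous equivariant maps $\gamma:\partial U\to Y^{k-1}$ ($G$ acting diagonally), there is $u\in\partial U$ with $\gamma(u)=0$. **Assumption on the functional.** Let $I=\Phi+\Psi:X\to(-\infty,\infty]$, where $\Phi\in C^1(X,\mathbb R)$, $\Psi:X\to(-\infty,\infty]$ is convex, lower semicontinuous and $\not\equiv\infty$, and both $\Phi$ and $\Psi$ are $G$-invariant. Assume that $\Psi$ is compatible with the action: $$\Psi\Big(\int_G\beta(gu)\,d\mu\Big)\le\int_G\Psi(\beta(gu))\,d\mu\qquad\text{for all }u\in X,\ \beta\in C(Gu,X).$$ A point $u$ with $I(u)<\infty$ is a *critical point* of $I$ (in Szulkin's sense) if $\langle\Phi'(u),v-u\rangle+\Psi(v)-\Psi(u)\ge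 0$ for all $v\in X$. Assume that $I$ satisfies the *(PS) condition*: for every $c\in\mathbb R$, every sequence $(u_n)$ with $I(u_n)<\infty$ for all $n$, $I(u_n)\to c$ and $$\langle\Phi'(u_n),v-u_n\rangle+\Psi(v)-\Psi(u_n)\ge-\varepsilon_n\|v-u_n\|\qquad\text{for all }n\text{ and all }v\in X,$$ for some $\varepsilon_n>0$ with $\varepsilon_n\to 0$, has a convergent subsequence. **Geometry.** Put $Y_k=\bigoplus_{j=1}^kX_j$ and $Z_k=\overline{\bigoplus_{j\ge k}X_j}$. Let $\rho_k>r_k>0$ for $k\ge2$, and put $B_k=\{u\in Y_k:\|u\|\le\rho_k\}$ and $\partial B_k=\{u\in Y_k:\|u\|=\rho_k\}$. Assume 1. $a_k:=\sup\{I(u):u\in Y_k,\ \|u\|=\rho_k\}\le 0$ for every $k\ge 2$; 2. $b_k:=\inf\{I(u):u\in Z_k,\ \|u\|=r_k\}\to\infty$ as $k\to\infty$. For $k\ge2$ let $\Theta_k$ be the set of continuous equivariant maps $\gamma:B_k\to X$ with $\gamma(u)=u$ for $u\in\partial B_k$, let $$c_k:=\inf_{\gamma\in\Theta_k}\ \sup_{u\in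 B_k}I(\gamma(u)),$$ and assume $c_k<\infty$ for every $k\ge2$. **Conclusion.** $c_k\to\infty$, and there is $k_0\ge 2$ such that for every $k\ge k_0$ there is a critical point $u_k$ of $I$ with $I(u_k)=c_k$. In particular, $I$ has infinitely many critical points. -/

import Mathlib

open Set Filter Topology MeasureTheory
open scoped ENNReal

namespace Fountain

noncomputable section

/-! ### Functionals `I = Φ + Ψ` and Szulkin's critical point theory -/

/-- Convexity of an extended real valued functional (used for functionals that never take the
value `-∞`). -/
def ConvexFunctional {X : Type*} [AddCommGroup X] [Module ℝ X] (Ψ : X → EReal) : Prop :=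
  ∀ x y : X, ∀ a b : ℝ, 0 ≤ a → 0 ≤ b → a + b = 1 →
    Ψ (a • x + b • y) ≤ (a : EReal) * Ψ x + (b : EReal) * Ψ y

/-- The functional `I = Φ + Ψ : X → (-∞, ∞]`. -/
def energy {X : Type*} (Φ : X → ℝ) (Ψ : X → EReal) (u : X) : EReal :=
  (Φ u : EReal) + Ψ u

/-- The class `(H₀)`: `Φ` is of class `C¹`, and `Ψ : X → (-∞, ∞]` is convex, lower semicontinuous
and not identically `∞`. -/
structure ClassH0 {X : Type*} [NormedAddCommGroup X] [NormedSpace ℝ X]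
    (Φ : X → ℝ) (Ψ : X → EReal) : Prop where
  contDiff : ContDiff ℝ 1 Φ
  ne_bot : ∀ x, Ψ x ≠ ⊥
  proper : ∃ x, Ψ x ≠ ⊤
  convex : ConvexFunctional Ψ
  lsc : LowerSemicontinuous Ψ

/-- `u` is a critical point of `Φ + Ψ` in the sense of Szulkin. -/
def IsCriticalPoint {X : Type*} [NormedAddCommGroup X] [NormedSpace ℝ X]
    (Φ : X → ℝ) (Ψ : X → EReal) (u : X) : Prop :=
  energy Φ Ψ u < ⊤ ∧ ∀ v : X, 0 ≤ ((fderiv ℝ Φ u (v - u) : ℝ) : EReal) + Ψ v - Ψ u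

/-- `u` is a Palais-Smale sequence of `Φ + Ψ` at level `c`. -/
def IsPSSequence {X : Type*} [NormedAddCommGroup X] [NormedSpace ℝ X]
    (Φ : X → ℝ) (Ψ : X → EReal) (c : ℝ) (u : ℕ → X) : Prop :=
  (∀ n, energy Φ Ψ (u n) < ⊤) ∧
  Tendsto (fun n => energy Φ Ψ (u n)) atTop (𝓝 (c : EReal)) ∧
  ∃ ε : ℕ → ℝ, (∀ n, 0 < ε n) ∧ Tendsto ε atTop (𝓝 0) ∧
    ∀ n, ∀ v : X, ((-(ε n * ‖v - u n‖) : ℝ) : EReal) ≤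
      ((fderiv ℝ Φ (u n) (v - u n) : ℝ) : EReal) + Ψ v - Ψ (u n)

/-- The Palais-Smale condition (at every real level). -/
def PSCondition {X : Type*} [NormedAddCommGroup X] [NormedSpace ℝ X]
    (Φ : X → ℝ) (Ψ : X → EReal) : Prop :=
  ∀ c : ℝ, ∀ u : ℕ → X, IsPSSequence Φ Ψ c u →
    ∃ φ : ℕ → ℕ, StrictMono φ ∧ ∃ x : X, Tendsto (u ∘ φ) atTop (𝓝 x)

/-! ### Group actions -/

/-- `A` is `G`-invariant: `gA = A` for every `g`. -/
def GInvariantSet (G : Type*) {X : Type*} [SMul G X] (A : Set X) : Prop :=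
  ∀ g : G, (fun x => g • x) '' A = A

/-- `φ` is a `G`-invariant functional. -/
def GInvariantFun (G : Type*) {X R : Type*} [SMul G X] (φ : X → R) : Prop :=
  ∀ (g : G) (x : X), φ (g • x) = φ x

/-- `γ` is equivariant on `A`. -/
def EquivariantOn (G : Type*) {X Z : Type*} [SMul G X] [SMul G Z] (γ : X → Z) (A : Set X) : Prop :=
  ∀ g : G, ∀ x ∈ A, γ (g • x) = g • γ x

/-- The action of `G` on `Y` is admissible. The group acts diagonally on `Yᵏ = (Fin k → Y)`. -/
def AdmissibleAction (G Y : Type*) [SMul G Y] [NormedAddCommGroup Y] : Prop :=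
  ∀ k : ℕ, 2 ≤ k → ∀ U : Set (Fin k → Y),
    IsOpen U → Bornology.IsBounded U → GInvariantSet G U → 0 ∈ U →
    ∀ γ : (Fin k → Y) → (Fin (k - 1) → Y),
      ContinuousOn γ (frontier U) → EquivariantOn G γ (frontier U) →
      ∃ u ∈ frontier U, γ u = 0

/-- The condition `(G₀)` for a continuous linear action of a compact group `G` on `X`: the action is
isometric, `X` is the closure of the direct sum of `G`-invariant subspaces `V j`, each
isomorphic, as a representation of `G`, to the finite dimensional representation `Y`, on which
the action is admissible. The subspaces are numbered from `0`, so that `V j` is `X_{j+1}`. -/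
structure ConditionG0 (G Y : Type*) {X : Type*} [SMul G X] [SMul G Y]
    [NormedAddCommGroup X] [NormedSpace ℝ X] [NormedAddCommGroup Y] [NormedSpace ℝ Y]
    (V : ℕ → Submodule ℝ X) : Prop where
  isometric : ∀ (g : G) (x : X), ‖g • x‖ = ‖x‖
  independent : iSupIndep V
  dense : (⨆ j, V j).topologicalClosure = ⊤
  invariant : ∀ j, GInvariantSet G (V j : Set X)
  equiv : ∀ j, ∃ e : V j ≃ₗ[ℝ] Y, ∀ (g : G) (x y : V j), (y : X) = g • (x : X) → e y = g • e x
  finiteDimensional : FiniteDimensional ℝ Y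
  admissible : AdmissibleAction G Y

/-- The normalized Haar measure of a compact group. -/
def normalizedHaar (G : Type*) [Group G] [TopologicalSpace G] [IsTopologicalGroup G]
    [CompactSpace G] [MeasurableSpace G] [BorelSpace G] : Measure G :=
  Measure.haarMeasure ⊤

/-- The integral of an extended real valued function, as the integral of its positive part minus
that of its negative part (below, the negative part always has a finite integral). -/
def erealIntegral {α : Type*} [MeasurableSpace α] (μ : Measure α) (f : α → EReal) : EReal :=
  ((∫⁻ a, (f a).toENNReal ∂μ : ℝ≥0∞) : EReal) - ((∫⁻ a, (-(f a)).toENNReal ∂μ : ℝ≥0∞) : EReal)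

/-- `Ψ` is compatible with the action of `G`:
`Ψ (∫ β(gu) dμ) ≤ ∫ Ψ(β(gu)) dμ` for all `u` and all continuous `β` on the orbit `Gu`. -/
def GCompatible (G : Type*) {X : Type*} [Group G] [TopologicalSpace G] [IsTopologicalGroup G]
    [CompactSpace G] [MeasurableSpace G] [BorelSpace G]
    [NormedAddCommGroup X] [NormedSpace ℝ X] [MulAction G X] (Ψ : X → EReal) : Prop :=
  ∀ (u : X) (β : X → X), ContinuousOn β (MulAction.orbit G u) →
    Ψ (∫ g : G, β (g • u) ∂(normalizedHaar G)) ≤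
      erealIntegral (normalizedHaar G) (fun g : G => Ψ (β (g • u)))

/-! ### The minimax levels -/

section Levels

variable {X : Type*} [NormedAddCommGroup X] [NormedSpace ℝ X]

/-- `Y_k = X_1 ⊕ ⋯ ⊕ X_k`, where `X_{j+1} = V j`. -/
def lowerSpace (V : ℕ → Submodule ℝ X) (k : ℕ) : Submodule ℝ X :=
  ⨆ j : ℕ, ⨆ _ : j + 1 ≤ k, V j

/-- `Z_k` is the closure of `X_k ⊕ X_{k+1} ⊕ ⋯`, where `X_{j+1} = V j`. -/
def upperSpace (V : ℕ → Submodule ℝ X) (k : ℕ) : Submodule ℝ X :=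
  (⨆ j : ℕ, ⨆ _ : k ≤ j + 1, V j).topologicalClosure

/-- The closed ball `B_k` of radius `ρ` in `Y_k`. -/
def lowerBall (V : ℕ → Submodule ℝ X) (k : ℕ) (ρ : ℝ) : Set X :=
  {u | u ∈ lowerSpace V k ∧ ‖u‖ ≤ ρ}

/-- The sphere `∂B_k` of radius `ρ` in `Y_k`. -/
def lowerSphere (V : ℕ → Submodule ℝ X) (k : ℕ) (ρ : ℝ) : Set X :=
  {u | u ∈ lowerSpace V k ∧ ‖u‖ = ρ}

/-- The sphere `N_k` of radius `r` in `Z_k`. -/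
def upperSphere (V : ℕ → Submodule ℝ X) (k : ℕ) (r : ℝ) : Set X :=
  {u | u ∈ upperSpace V k ∧ ‖u‖ = r}

/-- The class `Θ_k` of continuous equivariant maps `B_k → X` that are the identity on `∂B_k`
(only the values on `B_k` matter). -/
def minimaxClass (G : Type*) [SMul G X] (V : ℕ → Submodule ℝ X) (k : ℕ) (ρ : ℝ) : Set (X → X) :=
  {γ | ContinuousOn γ (lowerBall V k ρ) ∧ EquivariantOn G γ (lowerBall V k ρ) ∧
    ∀ u ∈ lowerSphere V k ρ, γ u = u}

/-- The minimax level `c_k = inf_{γ ∈ Θ_k} sup_{u ∈ B_k} I(γ(u))`. -/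
def minimaxLevel (G : Type*) [SMul G X] (V : ℕ → Submodule ℝ X) (I : X → EReal)
    (k : ℕ) (ρ : ℝ) : EReal :=
  ⨅ γ ∈ minimaxClass G V k ρ, ⨆ u ∈ lowerBall V k ρ, I (γ u)

end Levels

end

end Fountain

namespace Fountain

/-! The levels grow by linking, and positive levels are critical by deformation.

Linking (`ConditionG0.exists_mem_upperSphere`): for `γ ∈ Θ_k`, admissibility is applied to the set
of points of the open ball whose images have norm below `r_k`, and to `γ` followed by an equivariant
map `X → Yᵏ⁻¹` that vanishes only on `Z_k`. The zero found on the frontier is sent by `γ` into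
`N_k`. Hence `b_k ≤ c_k`, and `c_k → ∞`.

Deformation (`exists_isAlmostCritical_of_minimax`): let `c_k > 0`, so that the boundary values, of
energy at most `0`, stay below the level. Ekeland's principle for `γ ↦ sup I ∘ γ` on the complete
space of equivariant competitors gives a `γ` that no `η` improves by more than `ε * dist γ η`. If no
point of energy near `c_k` were almost critical, Szulkin's inequality would fail at every high point
of `γ`. The directions of failure, glued by a partition of unity and averaged over `G`, give a step
that moves `γ` by at most `t` and lowers the supremum by `2εt`, a contradiction. (PS) turns almost
critical points into a critical point at the exact level.

The difficulty is that `Ψ ∘ γ` is only lower semicontinuous. A direction `v` therefore carries real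
majorants of `Ψ v` and `‖v - u‖`; such triples (`descentSet`) form a closed convex set, stable under
gluing and Haar averaging. -/

/-! ### Ekeland's variational principle -/

/-- Ekeland's variational principle for a real valued lower semicontinuous function. -/
theorem exists_ekeland_real {M : Type*} [MetricSpace M] [CompleteSpace M] (f : M → ℝ)
    (hf : LowerSemicontinuous f) (c : ℝ) (hc : ∀ x, c ≤ f x) {ε : ℝ} (hε : 0 < ε) (x₀ : M) :
    ∃ x, f x ≤ f x₀ ∧ ∀ y, f x ≤ f y + ε * dist x y := by
  set S : M → Set M := fun x => {y | f y + ε * dist x y ≤ f x} with hS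
  have hself : ∀ x, x ∈ S x := fun x => by simp [hS]
  have hclosed : ∀ x, IsClosed (S x) := fun x => by
    have h : LowerSemicontinuous fun y => f y + ε * dist x y :=
      hf.add (Continuous.lowerSemicontinuous (by fun_prop))
    exact h.isClosed_preimage (f x)
  have htrans : ∀ x y, y ∈ S x → S y ⊆ S x := by
    intro x y hy z hz
    simp only [hS, Set.mem_ofPred_eq] at hy hz ⊢
    nlinarith [dist_triangle x y z]
  have hstep : ∀ (n : ℕ) (x : M), ∃ y ∈ S x, ∀ z ∈ S x, f y ≤ f z + (1 / 2) ^ n := by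
    intro n x
    have hbdd : BddBelow (f '' S x) := ⟨c, by rintro _ ⟨z, -, rfl⟩; exact hc z⟩
    have hne : (f '' S x).Nonempty := ⟨_, x, hself x, rfl⟩
    obtain ⟨_, ⟨y, hy, rfl⟩, hlt⟩ := exists_lt_of_csInf_lt hne
      (lt_add_of_pos_right (sInf (f '' S x)) (by positivity : (0 : ℝ) < (1 / 2) ^ n))
    refine ⟨y, hy, fun z hz => ?_⟩
    linarith [csInf_le hbdd ⟨z, hz, rfl⟩]
  choose nxt hnxt hmin using hstep
  let u : ℕ → M := fun n => Nat.rec x₀ (fun n x => nxt n x) n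
  have hu : ∀ n, u (n + 1) = nxt n (u n) := fun n => rfl
  have hanti : Antitone fun n => S (u n) := antitone_nat_of_succ_le fun n =>
    htrans _ _ (by rw [hu]; exact hnxt n (u n))
  -- `u (n + 1)` minimizes `f` on `S (u n)` up to `2⁻ⁿ`, which leaves little room for a further drop
  -- of `f`: the nested sets `S (u n)` shrink to a point.
  have hdist : ∀ n, ∀ y ∈ S (u (n + 1)), dist (u (n + 1)) y ≤ ε⁻¹ * (1 / 2) ^ n := by
    intro n y hy
    have h1 := hmin n (u n) y (hanti n.le_succ hy)
    rw [← hu] at h1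
    have h2 : f y + ε * dist (u (n + 1)) y ≤ f (u (n + 1)) := hy
    rw [inv_mul_eq_div, le_div_iff₀ hε]
    linarith
  have hgeom : Tendsto (fun n : ℕ => ε⁻¹ * (1 / 2 : ℝ) ^ n) atTop (𝓝 0) := by
    simpa using (tendsto_pow_atTop_nhds_zero_of_lt_one (by norm_num : (0 : ℝ) ≤ 1 / 2)
      (by norm_num)).const_mul ε⁻¹
  have hcau : CauchySeq fun n => u (n + 1) := by
    refine cauchySeq_of_le_tendsto_0' _ (fun n m hnm => ?_) hgeom
    exact hdist n _ (hanti (Nat.succ_le_succ hnm) (hself _))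
  obtain ⟨x, hx⟩ := cauchySeq_tendsto_of_complete hcau
  have hxS : ∀ n, x ∈ S (u n) := fun n =>
    (hclosed (u n)).mem_of_tendsto hx (eventually_atTop.2 ⟨n, fun m hm =>
      hanti (Nat.le_succ_of_le hm) (hself _)⟩)
  refine ⟨x, ?_, fun y => ?_⟩
  · have : f x + ε * dist x₀ x ≤ f x₀ := hxS 0
    nlinarith [dist_nonneg (x := x₀) (y := x)]
  · by_contra! hlt
    have hy : y ∈ S x := hlt.le
    have hlim : Tendsto (fun n => u (n + 1)) atTop (𝓝 y) :=
      tendsto_iff_dist_tendsto_zero.2 (squeeze_zero (fun _ => dist_nonneg)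
        (fun n => hdist n y (htrans _ _ (hxS (n + 1)) hy)) hgeom)
    rw [tendsto_nhds_unique hx hlim] at hlt
    simp at hlt

/-- Ekeland's variational principle for an extended real valued function. -/
theorem exists_ekeland {M : Type*} [MetricSpace M] [CompleteSpace M] (F : M → EReal)
    (hF : LowerSemicontinuous F) (c : ℝ) (hc : ∀ x, (c : EReal) ≤ F x) {ε : ℝ} (hε : 0 < ε)
    (x₀ : M) (hx₀ : F x₀ < ⊤) :
    ∃ x, F x ≤ F x₀ ∧ ∀ y, F x ≤ F y + ((ε * dist x y : ℝ) : EReal) := by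
  -- On this closed sublevel set `F` is real valued; outside it the required inequality is trivial.
  have hcl : IsClosed {x | F x ≤ F x₀} := hF.isClosed_preimage (F x₀)
  have : CompleteSpace {x | F x ≤ F x₀} := hcl.completeSpace_coe
  have hreal : ∀ x : {x | F x ≤ F x₀}, ((F x).toReal : EReal) = F x := fun x =>
    EReal.coe_toReal (x.2.trans_lt hx₀).ne (ne_bot_of_le_ne_bot (EReal.coe_ne_bot c) (hc x))
  obtain ⟨x, h1, h2⟩ := exists_ekeland_real (fun x : {x | F x ≤ F x₀} => (F x).toReal)
    (by
      intro x a ha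
      have ha' : (a : EReal) < F x := by rw [← hreal]; exact_mod_cast ha
      filter_upwards [continuous_subtype_val.continuousAt.eventually (hF x _ ha')] with y hy
      have hy' : (a : EReal) < F y := hy
      rw [← hreal] at hy'
      exact_mod_cast hy') c
    (fun x => by
      have := hc x
      rw [← hreal] at this
      exact_mod_cast this) hε ⟨x₀, le_refl (F x₀)⟩
  refine ⟨x, x.2, fun y => ?_⟩
  by_cases hy : F y ≤ F x₀
  · have := h2 ⟨y, hy⟩
    have hy' := hreal ⟨y, hy⟩
    rw [← hreal x, ← hy']
    exact_mod_cast this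
  · refine (x.2.trans (not_le.1 hy).le).trans ?_
    exact le_add_of_nonneg_right (by exact_mod_cast mul_nonneg hε.le dist_nonneg)

/-! ### Averaging over a compact group -/

section Average

section

variable {G E : Type*} [Group G] [NormedAddCommGroup E] [NormedSpace ℝ E] [DistribMulAction G E]
  [SMulCommClass G ℝ E]

/-- The continuous linear map given by the action of a group element. -/
def smulCLM [ContinuousConstSMul G E] (g : G) : E →L[ℝ] E where
  toFun x := g • x
  map_add' := smul_add g
  map_smul' c x := smul_comm g c x
  cont := continuous_const_smul g

@[simp] theorem smulCLM_apply [ContinuousConstSMul G E] (g : G) (x : E) :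
    smulCLM g x = g • x := rfl

end

variable {G : Type*} [Group G] [TopologicalSpace G] [IsTopologicalGroup G] [CompactSpace G]
  [MeasurableSpace G] [BorelSpace G]

instance isProbabilityMeasure_normalizedHaar : IsProbabilityMeasure (normalizedHaar G) :=
  ⟨by simpa [normalizedHaar] using
    Measure.haarMeasure_self (K₀ := (⊤ : TopologicalSpace.PositiveCompacts G))⟩

instance isMulLeftInvariant_normalizedHaar : (normalizedHaar G).IsMulLeftInvariant := by
  unfold normalizedHaar; infer_instance

variable {E : Type*} [NormedAddCommGroup E]

theorem _root_.Continuous.integrable_normalizedHaar {f : G → E} (hf : Continuous f) :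
    Integrable f (normalizedHaar G) :=
  hf.integrable_of_hasCompactSupport (HasCompactSupport.of_compactSpace f)

variable [NormedSpace ℝ E]

/-- Since `G` is compact, currying is continuous into `C(G, E)` with the sup norm, where integration
is 1-Lipschitz. -/
theorem continuous_integral_normalizedHaar {A : Type*} [TopologicalSpace A] {f : A → G → E}
    (hf : Continuous f.uncurry) : Continuous fun a => ∫ g, f a g ∂(normalizedHaar G) := by
  have h1 : Continuous fun φ : C(G, E) => ∫ g, φ g ∂(normalizedHaar G) := by
    refine LipschitzWith.continuous (K := 1) (LipschitzWith.of_dist_le_mul fun φ ψ => ?_)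
    rw [dist_eq_norm, ← integral_sub φ.continuous.integrable_normalizedHaar
      ψ.continuous.integrable_normalizedHaar]
    refine (norm_integral_le_of_norm_le_const (C := dist φ ψ) (ae_of_all _ fun g => ?_)).trans ?_
    · rw [← dist_eq_norm]; exact ContinuousMap.dist_apply_le_dist g
    · simp
  exact h1.comp (ContinuousMap.curry ⟨f.uncurry, hf⟩).continuous

variable [DistribMulAction G E]

variable (G) in
/-- The average `x ↦ ∫ g • f (g⁻¹ • x) dμ` of `f` over the compact group `G`. -/
noncomputable def haarAverage {A : Type*} [MulAction G A] (f : A → E) (x : A) : E :=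
  ∫ g : G, g • f (g⁻¹ • x) ∂(normalizedHaar G)

theorem continuous_haarAverage [ContinuousSMul G E] {A : Type*} [TopologicalSpace A]
    [MulAction G A] [ContinuousSMul G A] {f : A → E} (hf : Continuous f) :
    Continuous (haarAverage G f) :=
  continuous_integral_normalizedHaar (f := fun x (g : G) => g • f (g⁻¹ • x))
    (by simp only [Function.uncurry_def]; fun_prop)

theorem haarAverage_mem [ContinuousSMul G E] [CompleteSpace E] {A : Type*} [TopologicalSpace A]
    [MulAction G A] [ContinuousSMul G A] {f : A → E} (hf : Continuous f) {s : Set E}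
    (hs : Convex ℝ s) (hsc : IsClosed s) (x : A) (h : ∀ g : G, g • f (g⁻¹ • x) ∈ s) :
    haarAverage G f x ∈ s :=
  hs.integral_mem hsc (ae_of_all _ h) (Continuous.integrable_normalizedHaar (by fun_prop))

/-- Left invariance: after `g ↦ h * g` the factor `h` comes out of the integral. -/
theorem haarAverage_smul [SMulCommClass G ℝ E] [CompleteSpace E] [ContinuousSMul G E] {A : Type*}
    [TopologicalSpace A] [MulAction G A] [ContinuousSMul G A] {f : A → E} (hf : Continuous f)
    (h : G) (x : A) : haarAverage G f (h • x) = h • haarAverage G f x := by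
  have hint : Integrable (fun g : G => g • f (g⁻¹ • x)) (normalizedHaar G) :=
    Continuous.integrable_normalizedHaar (by fun_prop)
  have h2 := (smulCLM (E := E) h).integral_comp_comm hint
  simp only [smulCLM_apply] at h2
  rw [haarAverage, haarAverage, ← h2,
    ← integral_mul_left_eq_self (fun g : G => g • f (g⁻¹ • h • x)) h]
  refine integral_congr_ae (ae_of_all _ fun g => ?_)
  simp [mul_smul]

end Average

theorem energy_lt_top_iff {X : Type*} {Φ : X → ℝ} {Ψ : X → EReal} {u : X} :
    energy Φ Ψ u < ⊤ ↔ Ψ u < ⊤ := by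
  unfold energy
  induction Ψ u with
  | bot => simp
  | top => simp
  | coe a => simp [← EReal.coe_add, EReal.coe_lt_top]

/-! ### Descent directions and descent steps for the nonsmooth functional. -/

section Descent

variable {X : Type*} [NormedAddCommGroup X] [NormedSpace ℝ X] {Φ : X → ℝ} {Ψ : X → EReal}

/-- `u` has finite energy and satisfies Szulkin's variational inequality up to the error
`ε * ‖v - u‖`. -/
def IsAlmostCritical (Φ : X → ℝ) (Ψ : X → EReal) (ε : ℝ) (u : X) : Prop :=
  energy Φ Ψ u < ⊤ ∧ ∀ v : X, ((-(ε * ‖v - u‖) : ℝ) : EReal) ≤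
    ((fderiv ℝ Φ u (v - u) : ℝ) : EReal) + Ψ v - Ψ u

theorem ClassH0.continuous_fderiv (h : ClassH0 Φ Ψ) : Continuous (fderiv ℝ Φ) :=
  h.contDiff.continuous_fderiv one_ne_zero

theorem ClassH0.lowerSemicontinuous_energy (h : ClassH0 Φ Ψ) :
    LowerSemicontinuous (energy Φ Ψ) := by
  refine LowerSemicontinuous.add' (Continuous.lowerSemicontinuous
    (continuous_coe_real_ereal.comp h.contDiff.continuous)) h.lsc fun x => ?_
  exact EReal.continuousAt_add (Or.inl (EReal.coe_ne_top _)) (Or.inl (EReal.coe_ne_bot _))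

theorem ClassH0.coe_toReal (h : ClassH0 Φ Ψ) {u : X} (hu : Ψ u < ⊤) :
    ((Ψ u).toReal : EReal) = Ψ u :=
  EReal.coe_toReal hu.ne (h.ne_bot u)

/-- Szulkin's inequality is trivial where `Ψ v = ⊤`, so a violating `v` has finite `Ψ v`, which
serves as `q`. -/
theorem ClassH0.exists_descent_of_not_isAlmostCritical (h : ClassH0 Φ Ψ) {ε p : ℝ} {u : X}
    (hp : Ψ u = p) (hu : ¬ IsAlmostCritical Φ Ψ ε u) :
    ∃ v : X, ∃ q : ℝ, Ψ v ≤ q ∧ fderiv ℝ Φ u (v - u) + q + ε * ‖v - u‖ < p := by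
  have hfin : energy Φ Ψ u < ⊤ := energy_lt_top_iff.2 (by rw [hp]; exact EReal.coe_lt_top p)
  simp only [IsAlmostCritical, hfin, true_and, not_forall, not_le] at hu
  obtain ⟨v, hv⟩ := hu
  rw [hp] at hv
  have hvt : Ψ v < ⊤ := by
    by_contra hcon
    rw [not_lt_top_iff.1 hcon, EReal.coe_add_top, EReal.top_sub_coe] at hv
    exact not_top_lt hv
  refine ⟨v, (Ψ v).toReal, (h.coe_toReal hvt).ge, ?_⟩
  rw [← h.coe_toReal hvt] at hv
  have hv' : fderiv ℝ Φ u (v - u) + (Ψ v).toReal - p < -(ε * ‖v - u‖) := by exact_mod_cast hv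
  linarith

/-- Triples `(v, s, l)` such that `Ψ v ≤ s`, `‖v - u‖ ≤ l`, `v = u` if `fix` holds, and moving from
`u` towards `v` decreases the energy at a rate of at least `ε * l` if the energy of `u`, where
`Ψ u = p`, exceeds `L`. -/
def descentSet (Φ : X → ℝ) (Ψ : X → EReal) (ε L : ℝ) (fix : Prop) (u : X) (p : ℝ) :
    Set (X × ℝ × ℝ) :=
  {w | Ψ w.1 ≤ w.2.1 ∧ ‖w.1 - u‖ ≤ w.2.2 ∧ (fix → w.1 = u) ∧
    (L < Φ u + p → fderiv ℝ Φ u (w.1 - u) + w.2.1 + ε * w.2.2 ≤ p)}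

theorem ClassH0.isClosed_descentSet (h : ClassH0 Φ Ψ) (ε L : ℝ) (fix : Prop) (u : X) (p : ℝ) :
    IsClosed (descentSet Φ Ψ ε L fix u p) := by
  have h1 : IsClosed {w : X × ℝ × ℝ | Ψ w.1 ≤ w.2.1} :=
    h.lsc.isClosed_epigraph.preimage (f := fun w : X × ℝ × ℝ => (w.1, (w.2.1 : EReal)))
      (continuous_fst.prodMk (continuous_coe_real_ereal.comp (by fun_prop)))
  have h2 : IsClosed {w : X × ℝ × ℝ | ‖w.1 - u‖ ≤ w.2.2} :=
    isClosed_le (by fun_prop) (by fun_prop)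
  refine h1.inter (h2.inter (IsClosed.inter ?_ ?_))
  · exact isClosed_imp (by simp) (isClosed_eq (by fun_prop) (by fun_prop))
  · exact isClosed_imp (by simp) (isClosed_le (by fun_prop) (by fun_prop))

theorem ConvexFunctional.le_of_le (h : ConvexFunctional Ψ) {x y : X} {s t a b : ℝ}
    (hx : Ψ x ≤ s) (hy : Ψ y ≤ t) (ha : 0 ≤ a) (hb : 0 ≤ b) (hab : a + b = 1) :
    Ψ (a • x + b • y) ≤ ((a * s + b * t : ℝ) : EReal) := by
  refine (h x y a b ha hb hab).trans ?_
  rw [EReal.coe_add, EReal.coe_mul, EReal.coe_mul]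
  exact add_le_add (mul_le_mul_of_nonneg_left hx (by exact_mod_cast ha))
    (mul_le_mul_of_nonneg_left hy (by exact_mod_cast hb))

/-- With the majorants as extra coordinates the decrease condition is affine, and the other
conditions are an epigraph, a cone-like norm bound and an equation. Convexity permits both
partitions of unity and averaging. -/
theorem ClassH0.convex_descentSet (h : ClassH0 Φ Ψ) (ε L : ℝ) (fix : Prop) (u : X) (p : ℝ) :
    Convex ℝ (descentSet Φ Ψ ε L fix u p) := by
  rintro ⟨v, s, l⟩ ⟨h1, h2, h3, h4⟩ ⟨v', s', l'⟩ ⟨h1', h2', h3', h4'⟩ a b ha hb hab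
  simp only at h1 h2 h3 h4 h1' h2' h3' h4'
  have hsub : a • v + b • v' - u = a • (v - u) + b • (v' - u) := by
    have : u = a • u + b • u := by rw [← add_smul, hab, one_smul]
    nth_rewrite 1 [this]
    module
  refine ⟨h.convex.le_of_le h1 h1' ha hb hab, ?_, fun hf => ?_, fun hL => ?_⟩
  · change ‖a • v + b • v' - u‖ ≤ a * l + b * l'
    rw [hsub]
    refine (norm_add_le _ _).trans ?_
    rw [norm_smul, norm_smul, Real.norm_of_nonneg ha, Real.norm_of_nonneg hb]
    gcongr
  · change a • v + b • v' = u
    rw [h3 hf, h3' hf, ← add_smul, hab, one_smul]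
  · change fderiv ℝ Φ u (a • v + b • v' - u) + (a * s + b * s') + ε * (a * l + b * l') ≤ p
    rw [hsub, map_add, map_smul, map_smul, smul_eq_mul, smul_eq_mul]
    have e1 := mul_le_mul_of_nonneg_left (h4 hL) ha
    have e2 := mul_le_mul_of_nonneg_left (h4' hL) hb
    have e3 : p = a * p + b * p := by rw [← add_mul, hab, one_mul]
    rw [e3]
    linarith

theorem ClassH0.lowerSemicontinuous_of_coe_eq (h : ClassH0 Φ Ψ) {K : Type*} [TopologicalSpace K]
    (γ : C(K, X)) {p : K → ℝ} (hp : ∀ y, Ψ (γ y) = p y) : LowerSemicontinuous p := by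
  intro x a ha
  have ha' : (a : EReal) < Ψ (γ x) := by rw [hp]; exact_mod_cast ha
  filter_upwards [γ.continuous.continuousAt.eventually (h.lsc _ _ ha')] with y hy
  have hy' : (a : EReal) < Ψ (γ y) := hy
  rw [hp] at hy'
  exact_mod_cast hy'

/-- A continuous selection of the descent sets along a map `γ` without almost critical values
above the level `L`. -/
theorem ClassH0.exists_descent_field (h : ClassH0 Φ Ψ) {K : Type*} [MetricSpace K] (γ : C(K, X))
    {p : K → ℝ} (hp : ∀ y, Ψ (γ y) = p y) {S O : Set K} (hS : IsClosed S) (hO : IsOpen O)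
    (hSO : S ⊆ O) {R : K → X} (hR : ContinuousOn R O) (hRγ : ∀ y ∈ S, R y = γ y)
    (hRI : ∀ y ∈ O, energy Φ Ψ (R y) ≤ 0) {ε L : ℝ} (hε : 0 < ε) (hL : 0 < L)
    (hv : ∀ y, L ≤ Φ (γ y) + p y → ∃ v : X, ∃ q : ℝ, Ψ v ≤ q ∧
      fderiv ℝ Φ (γ y) (v - γ y) + q + ε * ‖v - γ y‖ < p y) :
    ∃ f : C(K, X × ℝ × ℝ), ∀ y, f y ∈ descentSet Φ Ψ ε L (y ∈ S) (γ y) (p y) ∧ 0 < (f y).2.2 := by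
  have hplsc := h.lowerSemicontinuous_of_coe_eq γ hp
  have hd := h.continuous_fderiv
  have hΦ := h.contDiff.continuous
  refine exists_continuous_forall_mem_convex_of_local
    (t := fun y => {w | w ∈ descentSet Φ Ψ ε L (y ∈ S) (γ y) (p y) ∧ 0 < w.2.2})
    (fun y => (h.convex_descentSet _ _ _ _ _).inter ?_) fun x => ?_
  · exact (convex_Ioi (0 : ℝ)).is_linear_preimage
      ⟨fun _ _ => rfl, fun _ _ => rfl⟩ (f := fun w : X × ℝ × ℝ => w.2.2)
  by_cases hxS : x ∈ S
  -- Near `S` the field aims at `R y`, which forces `v = γ y` on `S`. As `R y` has energy at most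
  -- `0`, `-Φ (R y)` is a majorant of `Ψ (R y)` that is continuous in `y`.
  · have hxO : O ∈ 𝓝 x := hO.mem_nhds (hSO hxS)
    have hRx : ContinuousAt R x := hR.continuousAt hxO
    have c1 : ContinuousAt (fun y => ‖R y - γ y‖) x := by fun_prop
    have c2 : ContinuousAt
        (fun y => fderiv ℝ Φ (γ y) (R y - γ y) - Φ (R y) + Φ (γ y) + L / 2) x := by
      have : ContinuousAt (fun y => fderiv ℝ Φ (γ y) (R y - γ y)) x :=
        ContinuousAt.clm_apply (by fun_prop) (by fun_prop)
      have h2 : ContinuousAt (fun y => Φ (R y)) x := hΦ.continuousAt.comp hRx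
      fun_prop
    have e1 := c1.eventually_lt_const (u := L / (2 * ε)) (by simp [hRγ x hxS]; positivity)
    have e2 := c2.eventually_lt_const (u := L) (by simp [hRγ x hxS]; linarith)
    refine ⟨_, inter_mem hxO (inter_mem e1 e2), fun y => (R y, -Φ (R y), L / (2 * ε)), ?_, ?_⟩
    · have hR' : ContinuousOn R (O ∩ ({y | ‖R y - γ y‖ < L / (2 * ε)} ∩
        {y | fderiv ℝ Φ (γ y) (R y - γ y) - Φ (R y) + Φ (γ y) + L / 2 < L})) :=
        hR.mono inter_subset_left
      exact hR'.prodMk ((hΦ.comp_continuousOn hR').neg.prodMk continuousOn_const)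
    · rintro y ⟨hyO, hy1, hy2⟩
      simp only [mem_ofPred_eq] at hy1 hy2
      refine ⟨⟨?_, hy1.le, fun hy => hRγ y hy, fun hI => ?_⟩, by simp; positivity⟩
      · have := hRI y hyO
        change Ψ (R y) ≤ ((-Φ (R y) : ℝ) : EReal)
        unfold energy at this
        have hb := h.ne_bot (R y)
        revert this hb
        induction Ψ (R y) with
        | bot => simp
        | top => simp
        | coe a =>
          intro h1 _
          have h2 : Φ (R y) + a ≤ 0 := by exact_mod_cast h1
          have h3 : a ≤ -Φ (R y) := by linarith
          exact_mod_cast h3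
      · have : ε * (L / (2 * ε)) = L / 2 := by field_simp
        simp only [this]
        linarith
  have hSx : Sᶜ ∈ 𝓝 x := hS.isOpen_compl.mem_nhds hxS
  have hconst : ∀ (v : X) (q l : ℝ), Ψ v ≤ q → ‖v - γ x‖ < l →
      (∀ᶠ y in 𝓝 x, L < Φ (γ y) + p y → fderiv ℝ Φ (γ y) (v - γ y) + q + ε * l ≤ p y) →
      ∃ U ∈ 𝓝 x, ∃ g : K → X × ℝ × ℝ, ContinuousOn g U ∧
        ∀ y ∈ U, g y ∈ {w | w ∈ descentSet Φ Ψ ε L (y ∈ S) (γ y) (p y) ∧ 0 < w.2.2} := by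
    intro v q l hvq hl hev
    have c1 : ContinuousAt (fun y => ‖v - γ y‖) x := by fun_prop
    have e1 := c1.eventually_lt_const hl
    refine ⟨_, inter_mem hSx (inter_mem e1 hev), fun _ => (v, q, l), continuousOn_const, ?_⟩
    rintro y ⟨hyS, hy1, hy2⟩
    simp only [mem_ofPred_eq] at hy1 hy2
    exact ⟨⟨hvq, hy1.le, fun hy => absurd hy hyS, hy2⟩, (norm_nonneg _).trans_lt hl⟩
  -- A low point can have neighbours above `L`, as `p` may jump up. Aiming these at `γ x` itself
  -- lowers their energy.
  by_cases hlow : Φ (γ x) + p x < L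
  · have c2 : ContinuousAt (fun y => fderiv ℝ Φ (γ y) (γ x - γ y) + p x +
        (L - (Φ (γ x) + p x)) / 2 + Φ (γ y)) x := by
      have : ContinuousAt (fun y => fderiv ℝ Φ (γ y) (γ x - γ y)) x :=
        ContinuousAt.clm_apply (by fun_prop) (by fun_prop)
      fun_prop
    have e2 := c2.eventually_lt_const (u := L) (by simp; linarith)
    refine hconst (γ x) (p x) ((L - (Φ (γ x) + p x)) / (2 * ε)) (hp x).le ?_ ?_
    · have : 0 < L - (Φ (γ x) + p x) := by linarith
      simp
      positivity
    · filter_upwards [e2] with y hy hI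
      have : ε * ((L - (Φ (γ x) + p x)) / (2 * ε)) = (L - (Φ (γ x) + p x)) / 2 := by field_simp
      rw [this]
      linarith
  -- At a high point a fixed violating direction keeps working nearby: the left side is continuous
  -- and `p` is lower semicontinuous, so part of the slack `e` survives.
  · obtain ⟨v, q, hvq, hlt⟩ := hv x (not_lt.1 hlow)
    set e := p x - (fderiv ℝ Φ (γ x) (v - γ x) + q + ε * ‖v - γ x‖) with he
    have hepos : 0 < e := by linarith
    have c2 : ContinuousAt (fun y => fderiv ℝ Φ (γ y) (v - γ y) + q +
        ε * (‖v - γ x‖ + e / (4 * ε))) x := by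
      have : ContinuousAt (fun y => fderiv ℝ Φ (γ y) (v - γ y)) x :=
        ContinuousAt.clm_apply (by fun_prop) (by fun_prop)
      fun_prop
    have h4 : ε * (‖v - γ x‖ + e / (4 * ε)) = ε * ‖v - γ x‖ + e / 4 := by field_simp
    have e2 := c2.eventually_lt_const (u := p x - e / 2) (by rw [h4]; linarith)
    refine hconst v q (‖v - γ x‖ + e / (4 * ε)) hvq (by
      have : 0 < e / (4 * ε) := by positivity
      linarith) ?_
    filter_upwards [e2, hplsc x (p x - e / 2) (by linarith)] with y hy1 hy2 _
    exact (hy1.trans hy2).le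

/-- Mean value inequality on a ball, with `Φ'` uniformly close to its values on the compact set `A`;
the ball itself may leave `A`. -/
theorem ClassH0.exists_uniform_taylor (h : ClassH0 Φ Ψ) {A : Set X} (hA : IsCompact A) {ε : ℝ}
    (hε : 0 < ε) : ∃ δ > 0, ∀ u ∈ A, ∀ w : X, ‖w‖ < δ →
      Φ (u + w) ≤ Φ u + fderiv ℝ Φ u w + ε * ‖w‖ := by
  have := hA.uniformContinuousAt_of_continuousAt (fderiv ℝ Φ)
    (fun a _ => h.continuous_fderiv.continuousAt) (Metric.dist_mem_uniformity hε)
  obtain ⟨δ, hδ, hsub⟩ := Metric.mem_uniformity_dist.1 this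
  refine ⟨δ, hδ, fun u hu w hw => ?_⟩
  have hball := (convex_ball u δ).norm_image_sub_le_of_norm_fderiv_le' (𝕜 := ℝ) (f := Φ)
    (φ := fderiv ℝ Φ u) (C := ε) (x := u) (y := u + w)
    (fun x _ => h.contDiff.differentiable one_ne_zero x) (fun x hx => ?_) (Metric.mem_ball_self hδ)
    (by simpa [Metric.mem_ball, dist_eq_norm] using hw)
  · have := (le_abs_self _).trans hball
    simp only [add_sub_cancel_left] at this
    linarith
  · have := hsub (a := u) (b := x) (by rw [dist_comm]; exact hx) hu
    rw [← dist_eq_norm, dist_comm]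
    exact le_of_lt this

/-- A small step along a descent field lowers the maximal energy. -/
theorem ClassH0.exists_descent_step (h : ClassH0 Φ Ψ) {K : Type*} [TopologicalSpace K]
    [CompactSpace K] (γ : C(K, X)) {p : K → ℝ} (hp : ∀ y, Ψ (γ y) = p y) {fix : K → Prop}
    {ε a m : ℝ} (hε : 0 < ε) (ha : ∀ y, Φ (γ y) + p y ≤ a) (hm : 0 < m) {f : K → X × ℝ × ℝ}
    (hf : Continuous f)
    (hfd : ∀ y, f y ∈ descentSet Φ Ψ (3 * ε) (a - ε) (fix y) (γ y) (p y))
    (hfm : ∀ y, m ≤ (f y).2.2) :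
    ∃ t, 0 < t ∧ ∀ y, energy Φ Ψ (γ y + (t / (f y).2.2) • ((f y).1 - γ y)) ≤
      ((a - 2 * ε * t : ℝ) : EReal) := by
  obtain ⟨δ, hδ, htaylor⟩ := h.exists_uniform_taylor (isCompact_range γ.continuous) hε
  have hplsc := h.lowerSemicontinuous_of_coe_eq γ hp
  have hd := h.continuous_fderiv
  -- `-p` is upper semicontinuous, so the slope is bounded above on the compact `K`.
  obtain ⟨C, hC⟩ : ∃ C : ℝ, ∀ y, fderiv ℝ Φ (γ y) ((f y).1 - γ y) + (f y).2.1 - p y ≤ C := by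
    have husc : UpperSemicontinuous fun y =>
        (fderiv ℝ Φ (γ y) ((f y).1 - γ y) + (f y).2.1) + -p y := by
      refine UpperSemicontinuous.add (Continuous.upperSemicontinuous ?_) ?_
      · have : Continuous fun y => fderiv ℝ Φ (γ y) ((f y).1 - γ y) :=
          Continuous.clm_apply (by fun_prop) (by fun_prop)
        fun_prop
      · intro x b hb
        filter_upwards [hplsc x (-b) (by linarith)] with y hy
        linarith
    obtain ⟨C, hC⟩ := (husc.upperSemicontinuousOn univ).bddAbove_of_isCompact isCompact_univ
    exact ⟨C, fun y => hC ⟨y, mem_univ y, by ring⟩⟩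
  set k := max C 0 / m with hk
  have hk0 : 0 ≤ k := by positivity
  -- `t ≤ m` makes `τ ≤ 1`, `t < δ` permits the Taylor estimate, and `t * (k + 3 * ε) ≤ ε` keeps
  -- points of energy at most `a - ε` below `a - 2 * ε * t`.
  set t := min (min m (δ / 2)) (ε / (k + 3 * ε)) with ht
  have htpos : 0 < t := by positivity
  have htm : t ≤ m := (min_le_left _ _).trans (min_le_left _ _)
  have htδ : t < δ := ((min_le_left _ _).trans (min_le_right _ _)).trans_lt (by linarith)
  have htk : t * (k + 3 * ε) ≤ ε := (le_div_iff₀ (by positivity)).1 (min_le_right _ _)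
  refine ⟨t, htpos, fun y => ?_⟩
  obtain ⟨hf1, hf2, -, hf4⟩ := hfd y
  specialize hC y
  specialize hfm y
  specialize ha y
  set v := (f y).1
  set s := (f y).2.1
  set l := (f y).2.2
  have hl : 0 < l := hm.trans_le hfm
  set τ := t / l with hτ
  have hτ0 : 0 ≤ τ := by positivity
  have hτ1 : τ ≤ 1 := (div_le_one hl).2 (htm.trans hfm)
  have hτl : τ * l = t := by rw [hτ]; field_simp
  have hw : ‖τ • (v - γ y)‖ ≤ t := by
    rw [norm_smul, Real.norm_of_nonneg hτ0, ← hτl]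
    gcongr
  have hΦ := htaylor (γ y) (mem_range_self y) (τ • (v - γ y)) (hw.trans_lt htδ)
  rw [map_smul, smul_eq_mul] at hΦ
  have hΨ : Ψ (γ y + τ • (v - γ y)) ≤ (((1 - τ) * p y + τ * s : ℝ) : EReal) := by
    have := h.convex.le_of_le (hp y).le hf1 (sub_nonneg.2 hτ1) hτ0 (by ring)
    convert this using 2
    module
  have hreal : Φ (γ y + τ • (v - γ y)) + ((1 - τ) * p y + τ * s) ≤ a - 2 * ε * t := by
    have hεw : ε * ‖τ • (v - γ y)‖ ≤ ε * t := by gcongr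
    -- High points gain `3εt` and lose `εt` to the Taylor error.
    by_cases hI : a - ε < Φ (γ y) + p y
    · have := mul_le_mul_of_nonneg_left (hf4 hI) hτ0
      have h3 : τ * (3 * ε * l) = 3 * ε * t := by rw [← hτl]; ring
      nlinarith
    · have h1 : τ * (fderiv ℝ Φ (γ y) (v - γ y) + s - p y) ≤ t * k := by
        calc _ ≤ τ * max C 0 := by gcongr; exact hC.trans (le_max_left _ _)
          _ ≤ (t / m) * max C 0 := by rw [hτ]; gcongr
          _ = t * k := by rw [hk]; ring
      nlinarith
  calc energy Φ Ψ (γ y + τ • (v - γ y))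
      ≤ (Φ (γ y + τ • (v - γ y)) : EReal) + (((1 - τ) * p y + τ * s : ℝ) : EReal) := by
        unfold energy; gcongr
    _ ≤ _ := by exact_mod_cast hreal

end Descent

/-! ### Almost critical points from an equivariant minimax. -/

/-- Continuous equivariant maps `K → X` agreeing with `R` on `S`. -/
def equivariantExtensions (G : Type*) {X : Type*} [NormedAddCommGroup X] [Group G]
    [DistribMulAction G X] {K : Type*}
    [TopologicalSpace K] [MulAction G K] (S : Set K) (R : K → X) : Set C(K, X) :=
  {γ | (∀ (g : G) (y : K), γ (g • y) = g • γ y) ∧ ∀ y ∈ S, γ y = R y}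

/-- Supplies the completeness that Ekeland's principle needs. -/
theorem isClosed_equivariantExtensions {G X : Type*} [NormedAddCommGroup X] [Group G]
    [DistribMulAction G X] [TopologicalSpace G] [ContinuousSMul G X] {K : Type*}
    [TopologicalSpace K] [MulAction G K] (S : Set K) (R : K → X) :
    IsClosed (equivariantExtensions G S R) := by
  have h1 : equivariantExtensions G S R = (⋂ (g : G) (y : K), {γ | γ (g • y) = g • γ y}) ∩
      ⋂ y ∈ S, {γ | γ y = R y} := by
    ext γ; simp [equivariantExtensions]
  rw [h1]
  refine IsClosed.inter (isClosed_iInter fun g => isClosed_iInter fun y => isClosed_eq ?_ ?_)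
    (isClosed_biInter fun y _ => isClosed_eq ?_ continuous_const)
  · exact continuous_eval_const _
  · exact (continuous_eval_const _).const_smul g
  · exact continuous_eval_const _

section Minimax

variable {X : Type*} [NormedAddCommGroup X] [NormedSpace ℝ X] {Φ : X → ℝ} {Ψ : X → EReal}
  {G : Type*} [Group G] [DistribMulAction G X]

theorem fderiv_smul_apply [SMulCommClass G ℝ X] [TopologicalSpace G] [ContinuousSMul G X]
    (h : ClassH0 Φ Ψ) (hΦG : GInvariantFun G Φ) (g : G) (u w : X) :
    fderiv ℝ Φ (g • u) (g • w) = fderiv ℝ Φ u w := by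
  have h1 : (Φ ∘ smulCLM (E := X) g) = Φ := funext fun x => hΦG g x
  have h2 := fderiv_comp u (h.contDiff.differentiable one_ne_zero (smulCLM (E := X) g u))
    (smulCLM (E := X) g).differentiableAt
  rw [h1, ContinuousLinearMap.fderiv] at h2
  rw [h2]
  rfl

theorem smul_mem_descentSet [SMulCommClass G ℝ X] [TopologicalSpace G] [ContinuousSMul G X]
    (h : ClassH0 Φ Ψ) (hΦG : GInvariantFun G Φ) (hΨG : GInvariantFun G Ψ)
    (hiso : ∀ (g : G) (x : X), ‖g • x‖ = ‖x‖) (g : G) {ε L p : ℝ} {fix : Prop} {u : X}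
    {w : X × ℝ × ℝ} (hw : w ∈ descentSet Φ Ψ ε L fix u p) :
    (g • w.1, w.2) ∈ descentSet Φ Ψ ε L fix (g • u) p := by
  obtain ⟨h1, h2, h3, h4⟩ := hw
  refine ⟨?_, ?_, fun hf => ?_, fun hI => ?_⟩
  · simpa only [hΨG g] using h1
  · simpa only [← smul_sub, hiso] using h2
  · simp only [h3 hf]
  · rw [hΦG g] at hI
    simpa only [← smul_sub, fderiv_smul_apply h hΦG] using h4 hI

variable [SMulCommClass G ℝ X] [TopologicalSpace G] [ContinuousSMul G X] [CompleteSpace X]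
  [IsTopologicalGroup G] [CompactSpace G] [MeasurableSpace G] [BorelSpace G]

/-- Averaging over `G` makes a descent field along an equivariant map equivariant. -/
theorem exists_equivariant_descent_field {K : Type*} [TopologicalSpace K] [MulAction G K]
    [ContinuousSMul G K] (h : ClassH0 Φ Ψ) (hΦG : GInvariantFun G Φ) (hΨG : GInvariantFun G Ψ)
    (hiso : ∀ (g : G) (x : X), ‖g • x‖ = ‖x‖) (γ : C(K, X)) {p : K → ℝ}
    (hp : ∀ y, Ψ (γ y) = p y) (hγ : ∀ (g : G) (y : K), γ (g • y) = g • γ y) {S : Set K}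
    (hS : ∀ (g : G), ∀ y ∈ S, g • y ∈ S) {ε L m : ℝ} (f : C(K, X × ℝ × ℝ))
    (hf : ∀ y, f y ∈ descentSet Φ Ψ ε L (y ∈ S) (γ y) (p y)) (hm : ∀ y, m ≤ (f y).2.2) :
    ∃ F : C(K, X × ℝ × ℝ), (∀ y, F y ∈ descentSet Φ Ψ ε L (y ∈ S) (γ y) (p y)) ∧
      (∀ y, m ≤ (F y).2.2) ∧ ∀ (g : G) (y : K), F (g • y) = (g • (F y).1, (F y).2) := by
  set φ : K → G → X × ℝ × ℝ := fun y g => (g • (f (g⁻¹ • y)).1, (f (g⁻¹ • y)).2) with hφ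
  have hφc : Continuous φ.uncurry := by
    simp only [hφ, Function.uncurry_def]
    fun_prop
  have hφi : ∀ y, Integrable (φ y) (normalizedHaar G) := fun y =>
    Continuous.integrable_normalizedHaar (by simp only [hφ]; fun_prop)
  have hpinv : ∀ (g : G) y, p (g • y) = p y := fun g y => by
    have := hp (g • y)
    rw [hγ, hΨG, hp] at this
    exact_mod_cast this.symm
  have hSiff : ∀ (g : G) y, y ∈ S ↔ g⁻¹ • y ∈ S := fun g y =>
    ⟨hS g⁻¹ y, fun hy => by simpa using hS g _ hy⟩
  refine ⟨⟨fun y => ∫ g, φ y g ∂(normalizedHaar G), continuous_integral_normalizedHaar hφc⟩,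
    fun y => ?_, fun y => ?_, fun g y => ?_⟩
  · refine (h.convex_descentSet _ _ _ _ _).integral_mem (h.isClosed_descentSet _ _ _ _ _)
      (ae_of_all _ fun g => ?_) (hφi y)
    have := smul_mem_descentSet h hΦG hΨG hiso g (hf (g⁻¹ • y))
    rwa [hγ, smul_inv_smul, hpinv, ← hSiff g y] at this
  · have hconv : Convex ℝ {w : X × ℝ × ℝ | m ≤ w.2.2} :=
      (convex_Ici m).is_linear_preimage ⟨fun _ _ => rfl, fun _ _ => rfl⟩
        (f := fun w : X × ℝ × ℝ => w.2.2)
    exact hconv.integral_mem (isClosed_le (by fun_prop) (by fun_prop))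
      (ae_of_all _ fun g => hm (g⁻¹ • y)) (hφi y)
  · have h1 := ((smulCLM (E := X) g).prodMap (ContinuousLinearMap.id ℝ (ℝ × ℝ))).integral_comp_comm
      (hφi y)
    change ∫ a, φ (g • y) a ∂(normalizedHaar G) = _
    rw [← integral_mul_left_eq_self (φ (g • y)) g]
    refine Eq.trans (integral_congr_ae (ae_of_all _ fun a => ?_)) h1
    simp [hφ, mul_smul]

/-- Almost critical points near a positive minimax level over equivariant maps. -/
theorem exists_isAlmostCritical_of_minimax {K : Type*} [MetricSpace K] [CompactSpace K]
    [Nonempty K] [MulAction G K] [ContinuousSMul G K] (h : ClassH0 Φ Ψ)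
    (hΦG : GInvariantFun G Φ) (hΨG : GInvariantFun G Ψ)
    (hiso : ∀ (g : G) (x : X), ‖g • x‖ = ‖x‖) {S O : Set K} (hS : IsClosed S)
    (hSG : ∀ (g : G), ∀ y ∈ S, g • y ∈ S) (hO : IsOpen O) (hSO : S ⊆ O) {R : K → X}
    (hR : ContinuousOn R O) (hRI : ∀ y ∈ O, energy Φ Ψ (R y) ≤ 0) {c : ℝ}
    (hc : ∀ γ ∈ equivariantExtensions G S R, (c : EReal) ≤ ⨆ y, energy Φ Ψ (γ y))
    {ε : ℝ} (hε : 0 < ε) (hεc : ε < c)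
    (hcε : ∃ γ ∈ equivariantExtensions G S R, ⨆ y, energy Φ Ψ (γ y) < ((c + ε : ℝ) : EReal)) :
    ∃ u, ((c - ε : ℝ) : EReal) ≤ energy Φ Ψ u ∧ energy Φ Ψ u ≤ ((c + ε : ℝ) : EReal) ∧
      IsAlmostCritical Φ Ψ (3 * ε) u := by
  have hMclosed := isClosed_equivariantExtensions (X := X) (G := G) S R
  have : CompleteSpace (equivariantExtensions G S R) := hMclosed.completeSpace_coe
  obtain ⟨γ₀, hγ₀, hγ₀c⟩ := hcε
  have hFlsc : LowerSemicontinuous fun γ : equivariantExtensions G S R =>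
      ⨆ y, energy Φ Ψ ((γ : C(K, X)) y) := by
    refine lowerSemicontinuous_iSup fun y => ?_
    exact h.lowerSemicontinuous_energy.comp
      ((continuous_eval_const y).comp continuous_subtype_val)
  obtain ⟨⟨γ, hγ⟩, hγle, hmin⟩ := exists_ekeland _ hFlsc c (fun γ => hc γ γ.2) hε ⟨γ₀, hγ₀⟩
    (hγ₀c.trans (EReal.coe_lt_top _))
  simp only [Subtype.forall, Subtype.dist_eq] at hγle hmin
  have hγc := hγle.trans_lt hγ₀c
  obtain ⟨a, ha⟩ : ∃ a : ℝ, ⨆ y, energy Φ Ψ (γ y) = a :=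
    ⟨_, (EReal.coe_toReal (hγc.trans (EReal.coe_lt_top _)).ne
      (ne_bot_of_le_ne_bot (EReal.coe_ne_bot c) (hc γ hγ))).symm⟩
  have hca : c ≤ a := by have := hc γ hγ; rw [ha] at this; exact_mod_cast this
  have hac : a < c + ε := by rw [ha] at hγc; exact_mod_cast hγc
  have hle : ∀ y, energy Φ Ψ (γ y) ≤ a := fun y => ha ▸ le_iSup (fun y => energy Φ Ψ (γ y)) y
  have hfin : ∀ y, Ψ (γ y) < ⊤ := fun y =>
    energy_lt_top_iff.1 ((hle y).trans_lt (EReal.coe_lt_top a))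
  set p : K → ℝ := fun y => (Ψ (γ y)).toReal
  have hp : ∀ y, Ψ (γ y) = p y := fun y => (h.coe_toReal (hfin y)).symm
  have hE : ∀ y, energy Φ Ψ (γ y) = ((Φ (γ y) + p y : ℝ) : EReal) := fun y => by
    rw [energy, hp]; rfl
  have hpa : ∀ y, Φ (γ y) + p y ≤ a := fun y => by
    have := hle y; rw [hE] at this; exact_mod_cast this
  by_contra! hcon
  obtain ⟨f, hf⟩ := h.exists_descent_field γ hp hS hO hSO hR (fun y hy => (hγ.2 y hy).symm) hRI
    (ε := 3 * ε) (L := a - ε) (by positivity) (by linarith) fun y hy =>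
      h.exists_descent_of_not_isAlmostCritical (hp y) (hcon (γ y)
        (by rw [hE]; exact_mod_cast (by linarith)) ((hle y).trans (by exact_mod_cast hac.le)))
  obtain ⟨y₀, -, hy₀⟩ := isCompact_univ.exists_isMinOn univ_nonempty
    (f.continuous.snd.snd).continuousOn
  obtain ⟨F, hFd, hFm, hFG⟩ := exists_equivariant_descent_field h hΦG hΨG hiso γ hp hγ.1 hSG f
    (fun y => (hf y).1) (m := (f y₀).2.2) fun y => hy₀ (mem_univ y)
  have hm : 0 < (f y₀).2.2 := (hf y₀).2
  obtain ⟨t, ht, hstep⟩ := h.exists_descent_step γ hp hε hpa hm F.continuous hFd hFm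
  have hpos : ∀ y, 0 < (F y).2.2 := fun y => hm.trans_le (hFm y)
  let η : C(K, X) := ⟨fun y => γ y + (t / (F y).2.2) • ((F y).1 - γ y), by
    have : Continuous fun y => t / (F y).2.2 :=
      continuous_const.div (by fun_prop) fun y => (hpos y).ne'
    fun_prop⟩
  have hη : η ∈ equivariantExtensions G S R := by
    refine ⟨fun g y => ?_, fun y hy => ?_⟩
    · simp only [η, ContinuousMap.coe_mk, hFG, hγ.1, ← smul_sub, smul_add]
      rw [smul_comm g]
    · simp [η, (hFd y).2.2.1 hy, hγ.2 y hy]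
  have hdist : dist γ η ≤ t := by
    refine (ContinuousMap.dist_le ht.le).2 fun y => ?_
    rw [dist_comm, dist_eq_norm]
    simp only [η, ContinuousMap.coe_mk, add_sub_cancel_left]
    rw [norm_smul, Real.norm_of_nonneg (by have := hpos y; positivity), div_mul_eq_mul_div,
      div_le_iff₀ (hpos y)]
    exact mul_le_mul_of_nonneg_left (hFd y).2.1 ht.le
  have hsup : ⨆ y, energy Φ Ψ (η y) ≤ ((a - 2 * ε * t : ℝ) : EReal) := iSup_le hstep
  -- The gain `2εt` exceeds the Ekeland penalty `εt`.
  have hfinal : (a : EReal) ≤ ((a - 2 * ε * t : ℝ) : EReal) + ((ε * t : ℝ) : EReal) := by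
    rw [← ha]
    refine (hmin η hη).trans (add_le_add hsup ?_)
    exact_mod_cast mul_le_mul_of_nonneg_left hdist hε.le
  have : a ≤ a - 2 * ε * t + ε * t := by exact_mod_cast hfinal
  nlinarith [mul_pos hε ht]

end Minimax

/-! ### Passage to the limit by the Palais-Smale condition. -/

/-- Under the Palais-Smale condition, almost critical points near the level `c` yield a critical
point at the level `c`. -/
theorem exists_isCriticalPoint_of_isAlmostCritical {X : Type*} [NormedAddCommGroup X]
    [NormedSpace ℝ X] {Φ : X → ℝ} {Ψ : X → EReal} (h : ClassH0 Φ Ψ) (hPS : PSCondition Φ Ψ)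
    {c : ℝ} (hc : 0 < c) (hac : ∀ ε : ℝ, 0 < ε → ε < c → ∃ u,
      ((c - ε : ℝ) : EReal) ≤ energy Φ Ψ u ∧ energy Φ Ψ u ≤ ((c + ε : ℝ) : EReal) ∧
        IsAlmostCritical Φ Ψ (3 * ε) u) :
    ∃ u, IsCriticalPoint Φ Ψ u ∧ energy Φ Ψ u = c := by
  set ε : ℕ → ℝ := fun n => c / ((n : ℝ) + 2) with hε
  have hεpos : ∀ n, 0 < ε n := fun n => by positivity
  have hεlt : ∀ n, ε n < c := fun n => div_lt_self hc (by
    have : (0 : ℝ) ≤ n := n.cast_nonneg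
    linarith)
  have hε0 : Tendsto ε atTop (𝓝 0) :=
    tendsto_const_nhds.div_atTop (tendsto_atTop_add_const_right _ _ tendsto_natCast_atTop_atTop)
  choose u hu1 hu2 hu3 using fun n => hac (ε n) (hεpos n) (hεlt n)
  have hΨu : ∀ n, Ψ (u n) = ((Ψ (u n)).toReal : EReal) := fun n =>
    (h.coe_toReal (energy_lt_top_iff.1 (hu3 n).1)).symm
  have hE : ∀ n, energy Φ Ψ (u n) = ((Φ (u n) + (Ψ (u n)).toReal : ℝ) : EReal) := fun n => by
    unfold energy
    nth_rewrite 1 [hΨu n]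
    rfl
  have hlim : Tendsto (fun n => Φ (u n) + (Ψ (u n)).toReal) atTop (𝓝 c) := by
    refine tendsto_of_tendsto_of_tendsto_of_le_of_le (g := fun n => c - ε n)
      (h := fun n => c + ε n) (by simpa using hε0.const_sub c) (by simpa using hε0.const_add c)
      (fun n => ?_) (fun n => ?_)
    · have := hu1 n; rw [hE] at this; exact_mod_cast this
    · have := hu2 n; rw [hE] at this; exact_mod_cast this
  have h3ε : Tendsto (fun n => 3 * ε n) atTop (𝓝 0) := by simpa using hε0.const_mul 3
  obtain ⟨φ, hφ, x, hx⟩ := hPS c u ⟨fun n => (hu3 n).1,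
    by simp only [hE]; exact (continuous_coe_real_ereal.tendsto c).comp hlim,
    fun n => 3 * ε n, fun n => by have := hεpos n; positivity, h3ε, fun n => (hu3 n).2⟩
  have hφt := hφ.tendsto_atTop
  have hΦx : Tendsto (fun n => Φ (u (φ n))) atTop (𝓝 (Φ x)) :=
    (h.contDiff.continuous.tendsto x).comp hx
  have hP : Tendsto (fun n => (Ψ (u (φ n))).toReal) atTop (𝓝 (c - Φ x)) := by
    simpa using (hlim.comp hφt).sub hΦx
  have hle : Ψ x ≤ ((c - Φ x : ℝ) : EReal) := by
    by_contra! hlt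
    obtain ⟨b, hb1, hb2⟩ := EReal.lt_iff_exists_real_btwn.1 hlt
    have hev : ∀ᶠ n in atTop, b ≤ (Ψ (u (φ n))).toReal := by
      filter_upwards [hx.eventually (h.lsc x _ hb2)] with n hn
      have hn' : (b : EReal) < Ψ (u (φ n)) := hn
      rw [hΨu] at hn'
      exact_mod_cast hn'.le
    exact absurd (EReal.coe_lt_coe_iff.1 hb1) (not_lt.2 (ge_of_tendsto hP hev))
  have hkey : ∀ (v : X) (q : ℝ), Ψ v = q → 0 ≤ fderiv ℝ Φ x (v - x) + q - (c - Φ x) := by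
    intro v q hq
    have h1 : ∀ n, -(3 * ε (φ n) * ‖v - u (φ n)‖) ≤
        fderiv ℝ Φ (u (φ n)) (v - u (φ n)) + q - (Ψ (u (φ n))).toReal := fun n => by
      have := (hu3 (φ n)).2 v
      rw [hq, hΨu] at this
      exact_mod_cast this
    have hsub : Tendsto (fun n => v - u (φ n)) atTop (𝓝 (v - x)) := hx.const_sub v
    have hd : Tendsto (fun n => fderiv ℝ Φ (u (φ n))) atTop (𝓝 (fderiv ℝ Φ x)) :=
      (h.continuous_fderiv.tendsto x).comp hx
    have hl : Tendsto (fun n => -(3 * ε (φ n) * ‖v - u (φ n)‖)) atTop (𝓝 0) := by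
      simpa using ((h3ε.comp hφt).mul hsub.norm).neg
    exact le_of_tendsto_of_tendsto' hl
      ((((isBoundedBilinearMap_apply.continuous.tendsto (_, _)).comp
        (hd.prodMk_nhds hsub)).add_const q).sub hP) h1
  have hxt : Ψ x < ⊤ := hle.trans_lt (EReal.coe_lt_top _)
  have hxr := h.coe_toReal hxt
  -- Testing the limit inequality with `v = x` reverses the bound from lower semicontinuity, so no
  -- energy is lost in the limit.
  have hxeq : (Ψ x).toReal = c - Φ x := by
    have h1 := hkey x _ hxr.symm
    rw [← hxr] at hle
    have h2 : (Ψ x).toReal ≤ c - Φ x := by exact_mod_cast hle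
    simp only [sub_self, map_zero, zero_add] at h1
    linarith
  rw [hxeq] at hxr
  refine ⟨x, ⟨energy_lt_top_iff.2 hxt, fun v => ?_⟩, ?_⟩
  · rw [← hxr]
    by_cases hv : Ψ v < ⊤
    · have hvr := h.coe_toReal hv
      rw [← hvr]
      exact_mod_cast hkey v _ hvr.symm
    · rw [not_lt_top_iff.1 hv, EReal.coe_add_top, EReal.top_sub_coe]
      exact le_top
  · rw [energy, ← hxr, ← EReal.coe_add]
    norm_num

/-! ### Linking through admissibility. -/

section Linking

variable {X : Type*} [NormedAddCommGroup X] [NormedSpace ℝ X]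
  {G : Type*} [Group G] [DistribMulAction G X]
  {Y : Type*} [NormedAddCommGroup Y] [NormedSpace ℝ Y] [DistribMulAction G Y]
  {V : ℕ → Submodule ℝ X}

theorem ConditionG0.smul_mem (h : ConditionG0 G Y V) (g : G) {j : ℕ} {x : X} (hx : x ∈ V j) :
    g • x ∈ V j := by
  have := h.invariant j g
  have h2 : g • x ∈ (fun x => g • x) '' (V j : Set X) := ⟨x, hx, rfl⟩
  rwa [this] at h2

/-- The space `Y_k` is isomorphic to `Yᵏ` as a representation of `G`. -/
theorem ConditionG0.exists_lowerSpace_param (h : ConditionG0 G Y V) (k : ℕ) :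
    ∃ J : (Fin k → Y) →ₗ[ℝ] X, Function.Injective J ∧ LinearMap.range J = lowerSpace V k ∧
      ∀ (g : G) (y : Fin k → Y), J (g • y) = g • J y := by
  choose e he using h.equiv
  have hsymm : ∀ j (g : G) (y : Y), (((e j).symm (g • y) : V j) : X) = g • ((e j).symm y : X) := by
    intro j g y
    have := he j g ((e j).symm y) ⟨g • ((e j).symm y : X), h.smul_mem g ((e j).symm y).2⟩ rfl
    rw [LinearEquiv.apply_symm_apply] at this
    rw [← this, LinearEquiv.symm_apply_apply]
  let J : (Fin k → Y) →ₗ[ℝ] X :=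
    ∑ i : Fin k, (V i).subtype ∘ₗ (e i).symm.toLinearMap ∘ₗ LinearMap.proj i
  have hJ : ∀ y, J y = ∑ i : Fin k, ((e i).symm (y i) : X) := fun y => by simp [J]
  refine ⟨J, ?_, le_antisymm ?_ ?_, fun g y => ?_⟩
  · refine (injective_iff_map_eq_zero J).2 fun y hy => funext fun i => ?_
    have hind := (iSupIndep_iff_finsetSum_eq_zero_imp_eq_zero _).1
      (h.independent.comp (f := fun i : Fin k => (i : ℕ)) Fin.val_injective) Finset.univ
      (fun i => ((e i).symm (y i) : X)) (fun i _ => ((e i).symm (y i)).2)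
      (by rw [← hJ, hy]) i (Finset.mem_univ i)
    simpa using hind
  · rintro _ ⟨y, rfl⟩
    rw [hJ]
    refine Submodule.sum_mem _ fun i _ => ?_
    exact (le_iSup₂_of_le (f := fun (j : ℕ) (_ : j + 1 ≤ k) => V j) (i : ℕ) i.2 le_rfl)
      ((e i).symm (y i)).2
  · refine iSup₂_le fun j hj x hx => ⟨Pi.single ⟨j, hj⟩ (e j ⟨x, hx⟩), ?_⟩
    rw [hJ, Finset.sum_eq_single ⟨j, hj⟩]
    · simp
    · intro i _ hi
      simp [Pi.single_eq_of_ne hi]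
    · simp
  · rw [hJ, hJ, Finset.smul_sum]
    exact Finset.sum_congr rfl fun i _ => hsymm i g (y i)

theorem ConditionG0.continuous_of_linear (h : ConditionG0 G Y V) {k : ℕ}
    (J : (Fin k → Y) →ₗ[ℝ] X) : Continuous J := by
  have := h.finiteDimensional
  exact J.continuous_of_finiteDimensional

theorem ConditionG0.isCompact_preimage_of_linear (h : ConditionG0 G Y V) {k : ℕ}
    {J : (Fin k → Y) →ₗ[ℝ] X} (hJ : Function.Injective J) (ρ : ℝ) :
    IsCompact {y | ‖J y‖ ≤ ρ} := by
  have := h.finiteDimensional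
  have hpr : ProperSpace (Fin k → Y) := FiniteDimensional.proper ℝ _
  obtain ⟨K, -, hK⟩ := J.injective_iff_antilipschitz.1 hJ
  refine Metric.isCompact_of_isClosed_isBounded
    (isClosed_le (h.continuous_of_linear J).norm continuous_const) ?_
  have := hK.isBounded_preimage (Metric.isBounded_closedBall (x := (0 : X)) (r := ρ))
  refine this.subset fun y hy => ?_
  simpa using hy

/-- Admissibility of the action on `Y`, for a domain bounded through a parametrization `J` of
the space `Y_k`. -/
theorem ConditionG0.exists_frontier_eq_zero (h : ConditionG0 G Y V) {k : ℕ} (hk : 2 ≤ k)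
    {J : (Fin k → Y) →ₗ[ℝ] X} (hJ : Function.Injective J) {ρ : ℝ} {U : Set (Fin k → Y)}
    (hU : IsOpen U) (hU0 : 0 ∈ U) (hUρ : ∀ y ∈ U, ‖J y‖ ≤ ρ)
    (hUG : ∀ (g : G), ∀ y ∈ U, g • y ∈ U) (γ : (Fin k → Y) → (Fin (k - 1) → Y))
    (hγ : ContinuousOn γ {y | ‖J y‖ ≤ ρ})
    (hγG : ∀ (g : G) (y : Fin k → Y), ‖J y‖ ≤ ρ → γ (g • y) = g • γ y) :
    ∃ y ∈ frontier U, γ y = 0 := by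
  have hfr : frontier U ⊆ {y | ‖J y‖ ≤ ρ} := frontier_subset_closure.trans
    (closure_minimal hUρ (isClosed_le (h.continuous_of_linear J).norm continuous_const))
  refine h.admissible k hk _ hU ((h.isCompact_preimage_of_linear hJ ρ).isBounded.subset hUρ)
    (fun g => ?_) hU0 γ (hγ.mono hfr) fun g y hy => hγG g y (hfr hy)
  ext y
  constructor
  · rintro ⟨z, hz, rfl⟩
    exact hUG g z hz
  · intro hy
    exact ⟨g⁻¹ • y, hUG g⁻¹ y hy, by simp⟩

/-- The constant map `Y² → Y` with a fixed vector as value is equivariant, so admissibility forces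
it to vanish somewhere. -/
theorem ConditionG0.eq_zero_of_fixed (h : ConditionG0 G Y V) {y : Y} (hy : ∀ g : G, g • y = y) :
    y = 0 := by
  obtain ⟨J, hJ, -, hJG⟩ := h.exists_lowerSpace_param 2
  obtain ⟨u, -, hu⟩ := h.exists_frontier_eq_zero le_rfl hJ (ρ := 1) (U := {y | ‖J y‖ < 1})
    (isOpen_lt (h.continuous_of_linear J).norm continuous_const) (by simp)
    (fun y hy => le_of_lt hy)
    (fun g y hy => by simpa only [mem_ofPred_eq, hJG, h.isometric] using hy)
    (fun _ _ => y) continuousOn_const (fun g _ _ => funext fun _ => (hy g).symm)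
  exact congrFun hu 0

theorem ConditionG0.smul_mem_lowerSpace (h : ConditionG0 G Y V) (g : G) {k : ℕ} {x : X}
    (hx : x ∈ lowerSpace V k) : g • x ∈ lowerSpace V k := by
  obtain ⟨J, -, hJr, hJG⟩ := h.exists_lowerSpace_param k
  rw [← hJr] at hx ⊢
  obtain ⟨y, rfl⟩ := hx
  exact ⟨g • y, hJG g y⟩

theorem ConditionG0.isClosed_summand (h : ConditionG0 G Y V) (j : ℕ) :
    IsClosed (V j : Set X) := by
  have := h.finiteDimensional
  obtain ⟨e, -⟩ := h.equiv j
  have : FiniteDimensional ℝ (V j) := e.symm.finiteDimensional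
  exact (V j).closed_of_finiteDimensional

variable [SMulCommClass G ℝ X] [TopologicalSpace G] [ContinuousSMul G X]

theorem ConditionG0.smul_mem_upperSpace (h : ConditionG0 G Y V) (g : G) {k : ℕ} {x : X}
    (hx : x ∈ upperSpace V k) : g • x ∈ upperSpace V k := by
  refine map_mem_closure (continuous_const_smul g) hx fun z hz => ?_
  have : (⨆ j : ℕ, ⨆ _ : k ≤ j + 1, V j) ≤
      (⨆ j : ℕ, ⨆ _ : k ≤ j + 1, V j).comap (smulCLM (E := X) g).toLinearMap :=
    iSup₂_le fun j hj x hx => (le_iSup₂_of_le (f := fun (j : ℕ) (_ : k ≤ j + 1) => V j) j hj le_rfl)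
      (h.smul_mem g hx)
  exact this hz

variable [IsTopologicalGroup G] [CompactSpace G] [MeasurableSpace G] [BorelSpace G]

/-- A continuous equivariant map `X → Yᵏ⁻¹` vanishing only on `Z_k`. -/
theorem ConditionG0.exists_equivariant_map [SMulCommClass G ℝ Y] [ContinuousSMul G Y]
    (h : ConditionG0 G Y V) (k : ℕ) :
    ∃ P : X → (Fin (k - 1) → Y), Continuous P ∧ (∀ (g : G) (x : X), P (g • x) = g • P x) ∧
      ∀ x, P x = 0 → x ∈ upperSpace V k := by
  have := h.finiteDimensional
  have : CompleteSpace (Fin (k - 1) → Y) := FiniteDimensional.complete ℝ _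
  obtain ⟨J, -, hJr, hJG⟩ := h.exists_lowerSpace_param (k - 1)
  have hJc := h.continuous_of_linear J
  set Z := upperSpace V k with hZ
  have hZc : IsClosed (Z : Set X) := Submodule.isClosed_topologicalClosure _
  let q : (Fin (k - 1) → Y) →ₗ[ℝ] X ⧸ Z := Z.mkQ ∘ₗ J
  -- The range of `q` is finite dimensional, hence closed; its preimage in `X` contains every `V j`,
  -- whose sum is dense.
  have hq : LinearMap.range q = ⊤ := by
    have hcl : IsClosed ((LinearMap.range q).comap Z.mkQ : Set X) :=
      (LinearMap.range q).closed_of_finiteDimensional.preimage Z.mkQL.continuous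
    have hle : (⨆ j, V j) ≤ (LinearMap.range q).comap Z.mkQ := iSup_le fun j x hx => by
      by_cases hj : k ≤ j + 1
      · have hxZ : x ∈ Z := Submodule.le_topologicalClosure _
          ((le_iSup₂_of_le (f := fun (j : ℕ) (_ : k ≤ j + 1) => V j) j hj le_rfl) hx)
        rw [Submodule.mem_comap, Submodule.mkQ_apply, (Submodule.Quotient.mk_eq_zero Z).2 hxZ]
        exact Submodule.zero_mem _
      · have hxJ : x ∈ LinearMap.range J := by
          rw [hJr]
          exact (le_iSup₂_of_le (f := fun (j : ℕ) (_ : j + 1 ≤ k - 1) => V j) j (by omega) le_rfl)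
            hx
        obtain ⟨y, rfl⟩ := hxJ
        exact ⟨y, rfl⟩
    have htop := Submodule.topologicalClosure_minimal _ hle hcl
    rw [h.dense, top_le_iff] at htop
    refine LinearMap.range_eq_top.2 fun z => ?_
    obtain ⟨x, rfl⟩ := Z.mkQ_surjective z
    have : x ∈ (LinearMap.range q).comap Z.mkQ := htop ▸ Submodule.mem_top
    exact this
  have : FiniteDimensional ℝ (X ⧸ Z) :=
    Module.Finite.of_surjective q (LinearMap.range_eq_top.1 hq)
  obtain ⟨s, hs⟩ := q.exists_rightInverse_of_surjective hq
  have hsc : Continuous s := s.continuous_of_finiteDimensional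
  have hPc : Continuous fun x => s (Z.mkQL x) := hsc.comp Z.mkQL.continuous
  have hPZ : ∀ x, J (s (Z.mkQL x)) - x ∈ Z := fun x => by
    rw [← Submodule.Quotient.eq]
    exact congrArg (fun T : X ⧸ Z →ₗ[ℝ] X ⧸ Z => T (Z.mkQ x)) hs
  refine ⟨haarAverage G fun x => s (Z.mkQL x), continuous_haarAverage hPc,
    fun g x => haarAverage_smul hPc g x, fun x hx => ?_⟩
  -- For each `x` the solutions of `J y - x ∈ Z` form a closed affine set, which contains the
  -- translates being averaged. Thus the average is still a lift of `x` modulo `Z`, and `0` is a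
  -- lift only if `x ∈ Z`.
  have hmem := haarAverage_mem (G := G) hPc (s := {y | J y - x ∈ Z})
    (fun y hy z hz a b _ _ hab => ?_)
    (hZc.preimage (f := fun y => J y - x) (by fun_prop)) x fun g => ?_
  · rw [hx] at hmem
    simpa using hmem
  · have hxx : J (a • y + b • z) - x = a • (J y - x) + b • (J z - x) := by
      have : x = a • x + b • x := by rw [← add_smul, hab, one_smul]
      nth_rewrite 1 [this]
      rw [map_add, map_smul, map_smul]
      module
    change J (a • y + b • z) - x ∈ Z
    rw [hxx]
    exact Z.add_mem (Z.smul_mem a hy) (Z.smul_mem b hz)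
  · have := h.smul_mem_upperSpace g (hPZ (g⁻¹ • x))
    rw [smul_sub, smul_inv_smul, ← hJG] at this
    exact this

variable [CompleteSpace X]

/-- The representation `X` has no nonzero fixed vectors. -/
theorem ConditionG0.eq_zero_of_fixed_ambient (h : ConditionG0 G Y V) {x : X}
    (hx : ∀ g : G, g • x = x) : x = 0 := by
  have hint : ∀ x : X, Integrable (fun g : G => g • x) (normalizedHaar G) := fun x =>
    Continuous.integrable_normalizedHaar (by fun_prop)
  let T : X →ₗ[ℝ] X :=
    { toFun := fun x => ∫ g : G, g • x ∂(normalizedHaar G)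
      map_add' := fun x y => by
        simp only [smul_add]
        exact integral_add (hint x) (hint y)
      map_smul' := fun c x => by
        simp only [smul_comm _ c]
        exact integral_smul c _ }
  have hTc : Continuous T :=
    continuous_integral_normalizedHaar (f := fun x (g : G) => g • x) (by
      simp only [Function.uncurry_def]; fun_prop)
  have hTfix : ∀ (a : G) (x : X), a • T x = T x := fun a x => by
    have h1 := (smulCLM (E := X) a).integral_comp_comm (hint x)
    refine h1.symm.trans ?_
    simp only [smulCLM_apply, smul_smul]
    exact integral_mul_left_eq_self (fun g : G => g • x) a
  -- `T` sends `V j` to fixed vectors of `V j ≅ Y`, which vanish; by density `T = 0`, whereas `T x =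
  -- x` for fixed `x`.
  have hker : (⨆ j, V j) ≤ LinearMap.ker T := iSup_le fun j x hx => by
    have hmem : T x ∈ V j := (V j).convex.integral_mem (h.isClosed_summand j)
      (ae_of_all _ fun g => h.smul_mem g hx) (hint x)
    obtain ⟨e, he⟩ := h.equiv j
    have h1 : e ⟨T x, hmem⟩ = 0 := h.eq_zero_of_fixed fun g =>
      (he g ⟨T x, hmem⟩ ⟨T x, hmem⟩ (hTfix g x).symm).symm
    have h2 := e.map_eq_zero_iff.1 h1
    exact congrArg Subtype.val h2
  have hclosed : IsClosed (LinearMap.ker T : Set X) :=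
    isClosed_eq hTc continuous_const
  have htop := Submodule.topologicalClosure_minimal _ hker hclosed
  rw [h.dense] at htop
  have hTx : T x = 0 := htop (Submodule.mem_top : x ∈ (⊤ : Submodule ℝ X))
  have hTx' : T x = x := by
    change ∫ g : G, g • x ∂(normalizedHaar G) = x
    simp [hx]
  rw [← hTx', hTx]

/-- The image of `B_k` under a map of the minimax class meets the sphere `N_k`. -/
theorem ConditionG0.exists_mem_upperSphere [SMulCommClass G ℝ Y] [ContinuousSMul G Y]
    (h : ConditionG0 G Y V) {k : ℕ} (hk : 2 ≤ k) {r ρ : ℝ} (hr : 0 < r) (hrρ : r < ρ) {γ : X → X}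
    (hγ : γ ∈ minimaxClass G V k ρ) :
    ∃ u ∈ lowerBall V k ρ, γ u ∈ upperSphere V k r := by
  obtain ⟨hγc, hγG, hγS⟩ := hγ
  obtain ⟨J, hJ, hJr, hJG⟩ := h.exists_lowerSpace_param k
  have hJc := h.continuous_of_linear J
  obtain ⟨P, hPc, hPG, hPZ⟩ := h.exists_equivariant_map k
  have hJl : ∀ y, J y ∈ lowerSpace V k := fun y => hJr ▸ LinearMap.mem_range_self J y
  have hmaps : MapsTo J {y | ‖J y‖ ≤ ρ} (lowerBall V k ρ) := fun y hy => ⟨hJl y, hy⟩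
  have hγJ : ContinuousOn (fun y => γ (J y)) {y | ‖J y‖ ≤ ρ} := hγc.comp hJc.continuousOn hmaps
  have hγJG : ∀ (g : G) (y : Fin k → Y), ‖J y‖ ≤ ρ → γ (J (g • y)) = g • γ (J y) :=
    fun g y hy => by rw [hJG]; exact hγG g _ (hmaps hy)
  have hγ0 : γ 0 = 0 := h.eq_zero_of_fixed_ambient (G := G) fun g => by
    have := hγJG g 0 (by simp; linarith)
    simpa using this.symm
  have hopen : IsOpen {y | ‖J y‖ < ρ} := isOpen_lt hJc.norm continuous_const
  have hUopen : IsOpen {y | ‖J y‖ < ρ ∧ ‖γ (J y)‖ < r} :=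
    (hγJ.mono fun y (hy : ‖J y‖ < ρ) => hy.le).norm.isOpen_inter_preimage hopen isOpen_Iio
  obtain ⟨y, hyU, hy0⟩ := h.exists_frontier_eq_zero hk hJ hUopen
    (by simpa [hγ0] using And.intro (hr.trans hrρ) hr) (fun y hy => hy.1.le)
    (fun g y hy => by
      rw [mem_ofPred_eq, hγJG g y hy.1.le, hJG, h.isometric, h.isometric]
      exact hy)
    (fun y => P (γ (J y))) (hPc.comp_continuousOn hγJ)
    (fun g y hy => by rw [hγJG g y hy, hPG])
  have hclosed : IsClosed {y | ‖J y‖ ≤ ρ} := isClosed_le hJc.norm continuous_const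
  have hsub : {y | ‖J y‖ < ρ ∧ ‖γ (J y)‖ < r} ⊆
      {y | ‖J y‖ ≤ ρ} ∩ (fun y => ‖γ (J y)‖) ⁻¹' Iic r := fun z hz => ⟨hz.1.le, hz.2.le⟩
  have hcl : y ∈ {y | ‖J y‖ ≤ ρ} ∩ (fun y => ‖γ (J y)‖) ⁻¹' Iic r :=
    closure_minimal hsub
      (hγJ.norm.preimage_isClosed_of_isClosed hclosed isClosed_Iic) (frontier_subset_closure hyU)
  have hyρ : ‖J y‖ ≤ ρ := hcl.1
  have hyr : ‖γ (J y)‖ ≤ r := hcl.2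
  -- On the sphere `γ` is the identity and `ρ > r`, so the frontier point comes from the constraint
  -- `‖γ (J y)‖ < r`.
  have hlt : ‖J y‖ < ρ := by
    refine lt_of_le_of_ne hyρ fun heq => ?_
    rw [hγS (J y) ⟨hJl y, heq⟩, heq] at hyr
    linarith
  refine ⟨J y, hmaps hyρ, hPZ _ hy0, le_antisymm hyr (not_lt.1 fun hlt' => ?_)⟩
  rw [hUopen.frontier_eq] at hyU
  exact hyU.2 ⟨hlt, hlt'⟩

end Linking

/-! ### The minimax levels. -/

section MinimaxLevel

variable {X : Type*} [NormedAddCommGroup X] [NormedSpace ℝ X]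
  {G : Type*} [Group G] [DistribMulAction G X]
  {Y : Type*} [NormedAddCommGroup Y] [NormedSpace ℝ Y] [DistribMulAction G Y]
  {V : ℕ → Submodule ℝ X}

theorem ConditionG0.isCompact_lowerBall (h : ConditionG0 G Y V) (k : ℕ) (ρ : ℝ) :
    IsCompact (lowerBall V k ρ) := by
  obtain ⟨J, hJ, hJr, -⟩ := h.exists_lowerSpace_param k
  convert (h.isCompact_preimage_of_linear hJ ρ).image (h.continuous_of_linear J) using 1
  ext x
  simp only [lowerBall, ← hJr, mem_image, mem_ofPred_eq, LinearMap.mem_range]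
  constructor
  · rintro ⟨⟨y, rfl⟩, hy⟩
    exact ⟨y, hy, rfl⟩
  · rintro ⟨y, hy, rfl⟩
    exact ⟨⟨y, rfl⟩, hy⟩

/-- The ball `B_k` as a `G`-invariant set. -/
def ConditionG0.invariantBall (h : ConditionG0 G Y V) (k : ℕ) (ρ : ℝ) : SubMulAction G X where
  carrier := lowerBall V k ρ
  smul_mem' g _ hx := ⟨h.smul_mem_lowerSpace g hx.1, (h.isometric g _).trans_le hx.2⟩

/-- Carries competitors on the compact ball back to `Θ_k`. Values off the ball are irrelevant, so
the extension by `0` suffices. -/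
theorem ConditionG0.exists_extension_mem_minimaxClass (h : ConditionG0 G Y V)
    {k : ℕ} {ρ : ℝ} {S : Set (h.invariantBall k ρ)}
    {R : h.invariantBall k ρ → X}
    (hS : ∀ y : h.invariantBall k ρ, ‖(y : X)‖ = ρ → y ∈ S ∧ R y = y)
    {γ : C(h.invariantBall k ρ, X)} (hγ : γ ∈ equivariantExtensions G S R) :
    ∃ η ∈ minimaxClass G V k ρ, ∀ y : h.invariantBall k ρ, η y = γ y := by
  classical
  let η : X → X := fun x => if hx : x ∈ h.invariantBall k ρ then γ ⟨x, hx⟩ else 0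
  have hη : ∀ y : h.invariantBall k ρ, η y = γ y := fun y => dif_pos y.2
  refine ⟨η, ⟨?_, fun g x hx => ?_, fun x hx => ?_⟩, hη⟩
  · rw [continuousOn_iff_continuous_domRestrict]
    exact γ.continuous.congr fun y => (hη y).symm
  · exact (hη (g • ⟨x, hx⟩)).trans ((hγ.1 g ⟨x, hx⟩).trans (congrArg _ (hη ⟨x, hx⟩).symm))
  · have hxB : x ∈ h.invariantBall k ρ := ⟨hx.1, hx.2.le⟩
    obtain ⟨h1, h2⟩ := hS ⟨x, hxB⟩ hx.2
    exact (hη ⟨x, hxB⟩).trans ((hγ.2 _ h1).trans h2)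

variable [SMulCommClass G ℝ X] [TopologicalSpace G] [ContinuousSMul G X] [CompleteSpace X]
  [IsTopologicalGroup G] [CompactSpace G] [MeasurableSpace G] [BorelSpace G] {Φ : X → ℝ}
  {Ψ : X → EReal}

/-- A positive minimax level is a critical level. -/
theorem exists_isCriticalPoint_minimaxLevel (h : ConditionG0 G Y V) (hH0 : ClassH0 Φ Ψ)
    (hPS : PSCondition Φ Ψ) (hΦG : GInvariantFun G Φ) (hΨG : GInvariantFun G Ψ) {k : ℕ} {ρ : ℝ}
    (hρ : 0 < ρ) (ha : ∀ u ∈ lowerSphere V k ρ, energy Φ Ψ u ≤ 0) {c : ℝ} (hc0 : 0 < c)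
    (hc : minimaxLevel G V (energy Φ Ψ) k ρ = c) :
    ∃ u, IsCriticalPoint Φ Ψ u ∧ energy Φ Ψ u = c := by
  set B := h.invariantBall k ρ
  have : CompactSpace B := isCompact_iff_compactSpace.1 (h.isCompact_lowerBall k ρ)
  have : Nonempty B := ⟨⟨0, (lowerSpace V k).zero_mem, by simpa using hρ.le⟩⟩
  let S : Set B := {y | ‖(y : X)‖ = ρ}
  let O : Set B := {y | (y : X) ≠ 0}
  -- Radial projection onto the sphere, defined near `S` and of energy at most `0` by the bound on
  -- `a_k`.
  let R : B → X := fun y => (ρ / ‖(y : X)‖) • (y : X)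
  have hRS : ∀ y : B, y ∈ S → R y = y := fun y (hy : ‖(y : X)‖ = ρ) => by
    simp only [R, hy, div_self hρ.ne', one_smul]
  refine exists_isCriticalPoint_of_isAlmostCritical hH0 hPS hc0 fun ε hε hεc =>
    exists_isAlmostCritical_of_minimax (K := B) (S := S) (O := O) (R := R) hH0 hΦG hΨG h.isometric
      (isClosed_eq (by fun_prop) continuous_const) (fun g y hy => (h.isometric g _).trans hy)
      (isOpen_ne_fun (by fun_prop) continuous_const) (fun y (hy : ‖(y : X)‖ = ρ) hy0 => ?_) ?_
      (fun y hy => ha _ ⟨?_, ?_⟩) (fun γ hγ => ?_) hε hεc ?_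
  · rw [hy0, norm_zero] at hy
    exact hρ.ne hy
  · refine ContinuousOn.smul (ContinuousOn.div continuousOn_const (by fun_prop) fun y hy => ?_)
      (by fun_prop)
    exact norm_ne_zero_iff.2 hy
  · exact (lowerSpace V k).smul_mem _ y.2.1
  · have hy' : ‖(y : X)‖ ≠ 0 := norm_ne_zero_iff.2 hy
    simp only [R, norm_smul, norm_div, norm_norm, Real.norm_of_nonneg hρ.le]
    field_simp
  · obtain ⟨η, hη, hηγ⟩ := h.exists_extension_mem_minimaxClass
      (fun y hy => ⟨hy, hRS y hy⟩) hγ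
    rw [← hc]
    refine iInf₂_le_of_le η hη (iSup₂_le fun u hu => ?_)
    rw [hηγ ⟨u, hu⟩]
    exact le_iSup (fun y : B => energy Φ Ψ (γ y)) ⟨u, hu⟩
  · have hlt : minimaxLevel G V (energy Φ Ψ) k ρ < ((c + ε : ℝ) : EReal) := by
      rw [hc]
      exact_mod_cast (by linarith)
    obtain ⟨η, hη⟩ := iInf_lt_iff.1 hlt
    obtain ⟨⟨hηc, hηG, hηS⟩, hη⟩ := iInf_lt_iff.1 hη
    refine ⟨⟨(lowerBall V k ρ).domRestrict η, continuousOn_iff_continuous_domRestrict.1 hηc⟩,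
      ⟨fun g y => hηG g y y.2, fun y hy => ?_⟩, lt_of_le_of_lt (iSup_le fun y => ?_) hη⟩
    · rw [hRS y hy]
      exact hηS y ⟨y.2.1, hy⟩
    · exact le_iSup₂ (f := fun u (_ : u ∈ lowerBall V k ρ) => energy Φ Ψ (η u)) (y : X) y.2

/-- Each competitor meets `N_k`, so its supremum is at least the infimum over `N_k`. -/
theorem le_minimaxLevel [SMulCommClass G ℝ Y] [ContinuousSMul G Y] (h : ConditionG0 G Y V)
    {k : ℕ} (hk : 2 ≤ k) {r ρ : ℝ} (hr : 0 < r) (hrρ : r < ρ) (I : X → EReal) :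
    (⨅ u ∈ upperSphere V k r, I u) ≤ minimaxLevel G V I k ρ := by
  refine le_iInf₂ fun γ hγ => ?_
  obtain ⟨u, hu, hγu⟩ := h.exists_mem_upperSphere hk hr hrρ hγ
  exact (iInf₂_le _ hγu).trans (le_iSup₂ (f := fun u (_ : u ∈ lowerBall V k ρ) => I (γ u)) u hu)

end MinimaxLevel

end Fountain

/-! ### The fountain theorem. -/

/-! The compatibility of `Ψ` with the action is not needed below: averages are controlled by
Jensen's inequality, which holds since `Ψ` is convex and lower semicontinuous. -/

theorem theorem3p1
    {X : Type*} [NormedAddCommGroup X] [NormedSpace ℝ X] [CompleteSpace X]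
    {G : Type*} [Group G] [TopologicalSpace G] [IsTopologicalGroup G] [CompactSpace G]
    [MeasurableSpace G] [BorelSpace G]
    [DistribMulAction G X] [SMulCommClass G ℝ X] [ContinuousSMul G X]
    {Y : Type*} [NormedAddCommGroup Y] [NormedSpace ℝ Y]
    [DistribMulAction G Y] [SMulCommClass G ℝ Y] [ContinuousSMul G Y]
    (V : ℕ → Submodule ℝ X) (hG0 : Fountain.ConditionG0 G Y V)
    (Φ : X → ℝ) (Ψ : X → EReal) (hH0 : Fountain.ClassH0 Φ Ψ)
    (hPS : Fountain.PSCondition Φ Ψ)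
    (hΦG : Fountain.GInvariantFun G Φ) (hΨG : Fountain.GInvariantFun G Ψ)
    (hcomp : Fountain.GCompatible G Ψ)
    (ρ r : ℕ → ℝ) (hr : ∀ k, 2 ≤ k → 0 < r k ∧ r k < ρ k)
    (ha : ∀ k, 2 ≤ k → (⨆ u ∈ Fountain.lowerSphere V k (ρ k), Fountain.energy Φ Ψ u) ≤ 0)
    (hb : Tendsto (fun k => ⨅ u ∈ Fountain.upperSphere V k (r k), Fountain.energy Φ Ψ u)
      atTop (𝓝 ⊤))
    (hc : ∀ k, 2 ≤ k → Fountain.minimaxLevel G V (Fountain.energy Φ Ψ) k (ρ k) < ⊤) :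
    (∃ k₀ : ℕ, 2 ≤ k₀ ∧ ∃ u : ℕ → X, ∀ k, k₀ ≤ k →
      Fountain.IsCriticalPoint Φ Ψ (u k) ∧
      Fountain.energy Φ Ψ (u k) = Fountain.minimaxLevel G V (Fountain.energy Φ Ψ) k (ρ k)) ∧
    Tendsto (fun k => Fountain.minimaxLevel G V (Fountain.energy Φ Ψ) k (ρ k)) atTop (𝓝 ⊤) ∧
    {u : X | Fountain.IsCriticalPoint Φ Ψ u}.Infinite := by
  have hlim : Tendsto (fun k => Fountain.minimaxLevel G V (Fountain.energy Φ Ψ) k (ρ k))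
      atTop (𝓝 ⊤) := by
    refine tendsto_of_tendsto_of_tendsto_of_le_of_le' hb tendsto_const_nhds
      ((eventually_ge_atTop 2).mono fun k hk => ?_) (Eventually.of_forall fun k => le_top)
    exact Fountain.le_minimaxLevel hG0 hk (hr k hk).1 (hr k hk).2 _
  obtain ⟨N, hN⟩ := eventually_atTop.1 (hlim.eventually (lt_mem_nhds EReal.zero_lt_top))
  have hcrit : ∀ k, max 2 N ≤ k → ∃ u, Fountain.IsCriticalPoint Φ Ψ u ∧
      Fountain.energy Φ Ψ u = Fountain.minimaxLevel G V (Fountain.energy Φ Ψ) k (ρ k) := by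
    intro k hk
    have hk2 : 2 ≤ k := (le_max_left _ _).trans hk
    have hpos := hN k ((le_max_right _ _).trans hk)
    have hreal := EReal.coe_toReal (hc k hk2).ne (ne_bot_of_gt hpos)
    rw [← hreal] at hpos ⊢
    exact Fountain.exists_isCriticalPoint_minimaxLevel hG0 hH0 hPS hΦG hΨG
      ((hr k hk2).1.trans (hr k hk2).2) (fun u hu => (le_iSup₂ (f := fun u
        (_ : u ∈ Fountain.lowerSphere V k (ρ k)) => Fountain.energy Φ Ψ u) u hu).trans (ha k hk2))
      (by exact_mod_cast hpos) hreal.symm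
  have hex : ∀ k, ∃ u, max 2 N ≤ k → Fountain.IsCriticalPoint Φ Ψ u ∧
      Fountain.energy Φ Ψ u = Fountain.minimaxLevel G V (Fountain.energy Φ Ψ) k (ρ k) := fun k => by
    by_cases hk : max 2 N ≤ k
    · exact (hcrit k hk).imp fun u hu _ => hu
    · exact ⟨0, fun hk' => absurd hk' hk⟩
  choose u hu using hex
  refine ⟨⟨max 2 N, le_max_left _ _, u, hu⟩, hlim, fun hfin => ?_⟩
  -- Finitely many critical points would have energies bounded by some `M < ⊤`, against `c_k → ∞`.
  obtain ⟨M, hMtop, hM⟩ : ∃ M : EReal, M < ⊤ ∧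
      ∀ v, Fountain.IsCriticalPoint Φ Ψ v → Fountain.energy Φ Ψ v ≤ M := by
    refine ⟨hfin.toFinset.sup (Fountain.energy Φ Ψ), ?_, fun v hv => ?_⟩
    · exact (Finset.sup_lt_iff bot_lt_top).2 fun v hv => (hfin.mem_toFinset.1 hv).1
    · exact Finset.le_sup (f := Fountain.energy Φ Ψ) (hfin.mem_toFinset.2 hv)
  obtain ⟨k, hk, hkM⟩ :=
    ((eventually_ge_atTop (max 2 N)).and (hlim.eventually (lt_mem_nhds hMtop))).exists
  rw [← (hu k hk).2] at hkM
  exact absurd hkM (not_lt.2 (hM _ (hu k hk).1))
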